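/- A labelled graph is a graph with a possibly infinite set of nodes, in which several (but only finitely many) edges may join two given distinct nodes, no edge joins a node to itself, and each edge $\gamma$ between nodes $i$ and $j$ carries a pair $(a^\gamma_{ij},a^\gamma_{ji})$ of positive integers. Its Cartan matrix is $c_{ij}=2\delta_{ij}-\sum_\gamma a^\gamma_{ij}$, the sum running over the edges $\gamma$ joining $i$ and $j$. An additive function is a function $n$ from the nodes to the positive rationals such that $\sum_i n(i)\,c_{ij}=0$ for every node $j$ (the sum being convergent). The graph is simply laced if all its edges are labelled $(1,1)$. A four-dimensional $\mathcal N=2$ super-Yang--Mills theory with bi-fundamental matter has a simply-laced labelled graph as its quiver (nodes are the gauge factors, the ranks are the $n(i)$, edges are the bi-fundamentals), and it is finite (vanishing one-loop $\beta$-functions, $2n(i)=\sum_j a_{ij}n(j)$ for all $i$) precisely when the ranks form an additive function. Statement. Let $T$ be a simply-laced labelled graph, possibly infinite, that carries an additive function. If $T$ is connected, then $T$ is isomorphic, as a labelled graph with unoriented edges, to one of the following graphs, all of whose edges are labelled $(1,1)$: a Euclidean (affine) graph $\widehat A_n$ ($n\ge1$; the cycle with $n+1$ nodes, which for $n=1$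 means two nodes joined by two edges), $\widehat D_n$ ($n\ge4$), $\widehat E_6$, $\widehat E_7$, $\widehat E_8$, or an infinite Dynkin graph $A_\infty$, $D_\infty$, $A_\infty^\infty$. In general $T$ is a disjoint union of such graphs, one for each of its connected components; in particular, if $T$ has finitely many connected components, then it is a finite disjoint union of such graphs. Hence the quiver of every finite $\mathcal N=2$ super-Yang--Mills theory with bi-fundamental matter whose quiver has finitely many connected components is a finite disjoint union of such graphs. -/

import Mathlib

universe u v w x

/-- A labelled graph: a (possibly infinite) set of nodes `V`, a set of edges `E` (several edges
may join the same two nodes) and, for each edge `γ` from `i = src γ` to `j = tgt γ`, a pair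
`label γ = (a_ij^γ, a_ji^γ)` of positive integers. The orientation of an edge only serves
to say which entry of the label is which; see `LabelledGraph.Iso`. -/
structure LabelledGraph : Type (max (u + 1) (v + 1)) where
  V : Type u
  E : Type v
  src : E → V
  tgt : E → V
  label : E → ℕ × ℕ
  label_fst_pos : ∀ γ, 0 < (label γ).1
  label_snd_pos : ∀ γ, 0 < (label γ).2

namespace LabelledGraph

/-- The edge `γ` joins the nodes `i` and `j`, in one direction or the other. -/
def Joins (T : LabelledGraph.{u, v}) (γ : T.E) (i j : T.V) : Prop :=
  (T.src γ = i ∧ T.tgt γ = j) ∨ (T.src γ = j ∧ T.tgt γ = i)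

/-- No edge joins a node to itself. -/
def Loopless (T : LabelledGraph.{u, v}) : Prop :=
  ∀ γ, T.src γ ≠ T.tgt γ

/-- Any two nodes are joined by finitely many edges only, so that the sum over `γ` in the
Cartan matrix makes sense. (A node may still have infinitely many neighbours.) -/
def FiniteMultiplicity (T : LabelledGraph.{u, v}) : Prop :=
  ∀ i j, {γ | T.Joins γ i j}.Finite

/-- Simply laced: every edge has the label `(1, 1)`. -/
def IsSimplyLaced (T : LabelledGraph.{u, v}) : Prop :=
  ∀ γ, T.label γ = (1, 1)

open Classical in
/-- The contribution `a_ij^γ` of the edge `γ`: it is `0` unless `γ` joins `i` and `j`. -/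
noncomputable def edgeLabel (T : LabelledGraph.{u, v}) (γ : T.E) (i j : T.V) : ℕ :=
  (if T.src γ = i ∧ T.tgt γ = j then (T.label γ).1 else 0) +
    (if T.src γ = j ∧ T.tgt γ = i then (T.label γ).2 else 0)

/-- The matrix `a_ij = ∑_γ a_ij^γ`, the sum running over the edges joining `i` and `j`. -/
noncomputable def adjacency (T : LabelledGraph.{u, v}) : Matrix T.V T.V ℤ :=
  fun i j => ((∑ᶠ γ, T.edgeLabel γ i j : ℕ) : ℤ)

open Classical in
/-- The Cartan matrix `c_ij = 2 δ_ij - a_ij`. -/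
noncomputable def cartan (T : LabelledGraph.{u, v}) : Matrix T.V T.V ℤ :=
  fun i j => (if i = j then 2 else 0) - T.adjacency i j

/-- An additive function: `n` takes positive rational values and, for every node `j`, the sum
`∑ᵢ n(i) c_ij` converges and vanishes. -/
def IsAdditive (T : LabelledGraph.{u, v}) (n : T.V → ℚ) : Prop :=
  (∀ i, 0 < n i) ∧ ∀ j, HasSum (fun i => n i * (T.cartan i j : ℚ)) 0

/-- The simple graph of adjacency, used for connectedness and connected components. -/
def underlying (T : LabelledGraph.{u, v}) : SimpleGraph T.V :=
  SimpleGraph.fromRel fun i j => ∃ γ, T.Joins γ i j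

/-- An isomorphism of labelled graphs: bijections of nodes and of edges that respect endpoints
and labels. An edge may be traversed in the opposite direction, its label being then swapped. -/
structure Iso (S : LabelledGraph.{u, v}) (T : LabelledGraph.{w, x}) where
  nodes : S.V ≃ T.V
  edges : S.E ≃ T.E
  compat : ∀ γ,
    (T.src (edges γ) = nodes (S.src γ) ∧ T.tgt (edges γ) = nodes (S.tgt γ) ∧
        T.label (edges γ) = S.label γ) ∨
      (T.src (edges γ) = nodes (S.tgt γ) ∧ T.tgt (edges γ) = nodes (S.src γ) ∧
        T.label (edges γ) = (S.label γ).swap)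

/-- The disjoint union of a family of labelled graphs. -/
def disjointUnion {ι : Type w} (G : ι → LabelledGraph.{0, 0}) : LabelledGraph.{w, w} where
  V := Σ i, (G i).V
  E := Σ i, (G i).E
  src γ := ⟨γ.1, (G γ.1).src γ.2⟩
  tgt γ := ⟨γ.1, (G γ.1).tgt γ.2⟩
  label γ := (G γ.1).label γ.2
  label_fst_pos γ := (G γ.1).label_fst_pos γ.2
  label_snd_pos γ := (G γ.1).label_snd_pos γ.2

/-- The graph with nodes `V`, and edges `E` with given endpoints, all labelled `(1, 1)`. -/
def simplyLaced {V E : Type} (s t : E → V) : LabelledGraph.{0, 0} where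
  V := V
  E := E
  src := s
  tgt := t
  label _ := (1, 1)
  label_fst_pos _ := Nat.one_pos
  label_snd_pos _ := Nat.one_pos

/-- The affine graph `Â_n` (`n ≥ 1`): a cycle of `n + 1` nodes; for `n = 1` this is two nodes
joined by two edges. -/
def affineA (n : ℕ) : LabelledGraph.{0, 0} :=
  simplyLaced (V := Fin (n + 1)) (E := Fin (n + 1)) (fun k => k) (fun k => k + 1)

/-- The affine graph `D̂_n` (`n ≥ 4`), with nodes `0, …, n`: the chain `1 - 2 - ⋯ - (n - 1)`
together with the edges `0 - 2` and `(n - 2) - n`. -/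
def affineD (n : ℕ) (hn : 4 ≤ n) : LabelledGraph.{0, 0} :=
  simplyLaced (V := Fin (n + 1)) (E := Fin n)
    (fun k => if k.val = n - 1 then ⟨n - 2, by omega⟩ else ⟨k.val, by omega⟩)
    (fun k => if k.val = 0 then ⟨2, by omega⟩ else ⟨k.val + 1, by omega⟩)

/-- The affine graph `Ê_6`: three arms of length `2` at the node `2`. -/
def affineE6 : LabelledGraph.{0, 0} :=
  simplyLaced (V := Fin 7) (E := Fin 6) ![0, 1, 2, 3, 2, 5] ![1, 2, 3, 4, 5, 6]

/-- The affine graph `Ê_7`: arms of lengths `3`, `3` and `1` at the node `3`. -/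
def affineE7 : LabelledGraph.{0, 0} :=
  simplyLaced (V := Fin 8) (E := Fin 7) ![0, 1, 2, 3, 4, 5, 3] ![1, 2, 3, 4, 5, 6, 7]

/-- The affine graph `Ê_8`: arms of lengths `2`, `5` and `1` at the node `2`. -/
def affineE8 : LabelledGraph.{0, 0} :=
  simplyLaced (V := Fin 9) (E := Fin 8) ![0, 1, 2, 3, 4, 5, 6, 2] ![1, 2, 3, 4, 5, 6, 7, 8]

/-- `A_∞`: the half-infinite chain `0 - 1 - 2 - ⋯`. -/
def infiniteA : LabelledGraph.{0, 0} :=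
  simplyLaced (V := ℕ) (E := ℕ) (fun k => k) (fun k => k + 1)

/-- `D_∞`: the half-infinite chain `1 - 2 - 3 - ⋯` together with the edge `0 - 2`. -/
def infiniteD : LabelledGraph.{0, 0} :=
  simplyLaced (V := ℕ) (E := ℕ) (fun k => k) (fun k => if k = 0 then 2 else k + 1)

/-- `A_∞^∞`: the chain infinite in both directions. -/
def biinfiniteA : LabelledGraph.{0, 0} :=
  simplyLaced (V := ℤ) (E := ℤ) (fun k => k) (fun k => k + 1)

/-- The types of the simply-laced Euclidean and infinite Dynkin graphs. -/
inductive DiagramType : Type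
  | affA (n : ℕ) (hn : 1 ≤ n)
  | affD (n : ℕ) (hn : 4 ≤ n)
  | affE6
  | affE7
  | affE8
  | infA
  | infD
  | biinfA

/-- The graph of a given type. -/
def DiagramType.graph : DiagramType → LabelledGraph.{0, 0}
  | .affA n _ => affineA n
  | .affD n hn => affineD n hn
  | .affE6 => affineE6
  | .affE7 => affineE7
  | .affE8 => affineE8
  | .infA => infiniteA
  | .infD => infiniteD
  | .biinfA => biinfiniteA

end LabelledGraph

/-! Additivity at a node j says that the values of n at the other ends of the edges at j add up to
twice n(j). Since n is positive, any selection of these edges has partial sum at most 2n(j), with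
equality exactly when no edge is left out. This makes affine diagrams rigid: when a copy of one sits
inside T, its null vector combines the local inequalities into an equality, so each of them is sharp
and no further edge meets the copy. A connected T then has nothing outside it
(`nonempty_iso_of_saturated`). Cycles, double edges included, are treated in `nonempty_iso_affineA`,
double forks in `saturated_of_double_fork`, and the exceptional diagrams in `nonempty_iso_affineE6`,
`nonempty_iso_affineE7` and `nonempty_iso_affineE8`.

What remains is a tree containing no double fork. Along a chain of nodes with two neighbours, n is
affine. If nothing branches, T is a chain; positivity of n forbids two ends, which leaves A_∞ and
A_∞^∞. If exactly one node branches and it has three neighbours, T is a star of three arms, and an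
arm with p + 1 nodes beyond the centre has first value (p + 1)/(p + 2) times the central one
(`IsArm.apply_of_endsAt`). Without an Ê_6 some arm has a single node; without an Ê_7 a second arm
has at most two. Arms 1, 1 force the third to be infinite, which is D_∞; arms 1, 2 force at least
five nodes on the third, which is Ê_8.

The assumed convergence enters only to show that each node meets finitely many edges
(`IsAdditive.isBalanced`). Balance passes to connected components, so the general case follows from
the connected one. -/

namespace LabelledGraph

/-! ### From convergent sums to a finite local balance -/

open Classical in
/-- The endpoint of the edge `γ` other than `j`. -/
noncomputable def other (T : LabelledGraph.{u, v}) (γ : T.E) (j : T.V) : T.V :=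
  if T.src γ = j then T.tgt γ else T.src γ

/-- The local form of additivity: finitely many edges meet each node `j`, and the values of `n` at
their other endpoints add up to `2 * n j`. -/
def IsBalanced (T : LabelledGraph.{u, v}) (n : T.V → ℚ) : Prop :=
  (∀ i, 0 < n i) ∧ ∀ j, ∃ S : Finset T.E,
    (∀ γ, γ ∈ S ↔ T.src γ = j ∨ T.tgt γ = j) ∧ ∑ γ ∈ S, n (T.other γ j) = 2 * n j

theorem Joins.symm {T : LabelledGraph.{u, v}} {γ : T.E} {i j : T.V} (h : T.Joins γ i j) :
    T.Joins γ j i := Or.symm h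

theorem Joins.other_eq {T : LabelledGraph.{u, v}} {γ : T.E} {i j : T.V} (h : T.Joins γ i j)
    (hij : i ≠ j) : T.other γ i = j := by
  unfold other
  rcases h with ⟨h1, h2⟩ | ⟨h1, h2⟩
  · simp [h1, h2]
  · simp [h1, hij.symm]

theorem Joins.incident {T : LabelledGraph.{u, v}} {γ : T.E} {i j : T.V} (h : T.Joins γ i j) :
    T.src γ = i ∨ T.tgt γ = i := by
  rcases h with h | h
  · exact Or.inl h.1
  · exact Or.inr h.2

theorem joins_other {T : LabelledGraph.{u, v}} {γ : T.E} {i : T.V}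
    (h : T.src γ = i ∨ T.tgt γ = i) : T.Joins γ i (T.other γ i) := by
  unfold other Joins
  by_cases h1 : T.src γ = i
  · simp [h1]
  · simp [h1, h.resolve_left h1]

theorem Joins.ne {T : LabelledGraph.{u, v}} (hloop : T.Loopless) {γ : T.E} {i j : T.V}
    (h : T.Joins γ i j) : i ≠ j := by
  rintro rfl
  rcases h with h | h <;> exact hloop γ (h.1.trans h.2.symm)

theorem underlying_adj {T : LabelledGraph.{u, v}} (hloop : T.Loopless) {i j : T.V} :
    T.underlying.Adj i j ↔ ∃ γ, T.Joins γ i j := by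
  simp only [underlying, SimpleGraph.fromRel_adj]
  constructor
  · rintro ⟨-, ⟨γ, h⟩ | ⟨γ, h⟩⟩
    exacts [⟨γ, h⟩, ⟨γ, h.symm⟩]
  · rintro ⟨γ, h⟩
    exact ⟨h.ne hloop, Or.inl ⟨γ, h⟩⟩

theorem IsBalanced.sum_le {T : LabelledGraph.{u, v}} {n : T.V → ℚ} (hn : T.IsBalanced n) {j : T.V}
    {S : Finset T.E} (hS : ∀ γ ∈ S, T.src γ = j ∨ T.tgt γ = j) :
    ∑ γ ∈ S, n (T.other γ j) ≤ 2 * n j := by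
  obtain ⟨S', h1, h2⟩ := hn.2 j
  rw [← h2]
  exact Finset.sum_le_sum_of_subset_of_nonneg (fun γ h => (h1 γ).2 (hS γ h))
    fun _ _ _ => (hn.1 _).le

theorem IsBalanced.mem_of_le_sum {T : LabelledGraph.{u, v}} {n : T.V → ℚ} (hn : T.IsBalanced n)
    {j : T.V} {S : Finset T.E} (hS : ∀ γ ∈ S, T.src γ = j ∨ T.tgt γ = j)
    (hle : 2 * n j ≤ ∑ γ ∈ S, n (T.other γ j)) {γ : T.E} (hγ : T.src γ = j ∨ T.tgt γ = j) :
    γ ∈ S := by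
  classical
  by_contra hγS
  have := hn.sum_le (j := j) (S := insert γ S)
    (by simp only [Finset.mem_insert]; rintro _ (rfl | h); exacts [hγ, hS _ h])
  rw [Finset.sum_insert hγS] at this
  linarith [hn.1 (T.other γ j)]

open Classical in
theorem adjacency_eq {T : LabelledGraph.{u, v}} (hloop : T.Loopless)
    (hfin : T.FiniteMultiplicity) (hlaced : T.IsSimplyLaced) (i j : T.V) :
    T.adjacency i j = ({γ | T.Joins γ i j}.ncard : ℤ) := by
  have h : ∀ γ, T.edgeLabel γ i j = if T.Joins γ i j then 1 else 0 := by
    intro γ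
    have := hloop γ
    simp only [edgeLabel, hlaced γ]
    by_cases h1 : T.src γ = i ∧ T.tgt γ = j <;> by_cases h2 : T.src γ = j ∧ T.tgt γ = i
    · exact absurd (h1.1.trans h2.2.symm) this
    · rw [if_pos h1, if_neg h2, if_pos (show T.Joins γ i j from Or.inl h1)]
    · rw [if_neg h1, if_pos h2, if_pos (show T.Joins γ i j from Or.inr h2)]
    · rw [if_neg h1, if_neg h2, if_neg (fun h => h.elim h1 h2)]
  have h' : ∑ᶠ γ, T.edgeLabel γ i j = {γ | T.Joins γ i j}.ncard := by
    rw [finsum_congr h, finsum_eq_finsetSum_of_support_subset (s := (hfin i j).toFinset),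
      Set.ncard_eq_toFinset_card _ (hfin i j), Finset.card_eq_sum_ones]
    · exact Finset.sum_congr rfl fun γ hγ => if_pos ((Set.Finite.mem_toFinset _).1 hγ)
    · intro γ hγ
      rw [Set.Finite.coe_toFinset]
      by_contra hc
      exact hγ (if_neg hc)
  rw [adjacency, h']

theorem IsAdditive.isBalanced {T : LabelledGraph.{u, v}} (hloop : T.Loopless)
    (hfin : T.FiniteMultiplicity) (hlaced : T.IsSimplyLaced) {n : T.V → ℚ}
    (hn : T.IsAdditive n) : T.IsBalanced n := by
  classical
  refine ⟨hn.1, fun j => ?_⟩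
  have hself : ∀ i, T.adjacency i i = 0 := fun i => by
    rw [adjacency_eq hloop hfin hlaced]
    have : {γ | T.Joins γ i i} = ∅ := Set.eq_empty_of_forall_notMem fun γ h => h.ne hloop rfl
    simp [this]
  have hadjpos : ∀ i j γ, T.Joins γ i j → (1 : ℚ) ≤ T.adjacency i j := fun i j γ h => by
    rw [adjacency_eq hloop hfin hlaced]
    have : 0 < {γ | T.Joins γ i j}.ncard := (Set.ncard_pos (hfin i j)).2 ⟨γ, h⟩
    exact_mod_cast this
  have hadjnn : ∀ i j, (0 : ℚ) ≤ T.adjacency i j := fun i j => by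
    rw [adjacency_eq hloop hfin hlaced]; positivity
  -- In the negated sum at `i` only the diagonal term is negative, so the partial sum over `{i, j}`
  -- is at most the total, 0.
  have hle : ∀ i γ, T.Joins γ i j → n j ≤ 2 * n i := by
    intro i γ h
    have hij := h.ne hloop
    have h1 := (hn.2 i).neg
    have h2 := sum_le_hasSum {i, j} (fun k hk => ?_) h1
    · rw [Finset.sum_pair hij] at h2
      simp only [cartan, if_true, hself, if_neg hij.symm] at h2
      push_cast at h2
      have := mul_le_mul_of_nonneg_left (hadjpos j i γ h.symm) (hn.1 j).le
      linarith
    · simp only [Finset.mem_insert, Finset.mem_singleton, not_or] at hk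
      simp only [cartan, if_neg hk.1]
      push_cast
      have := mul_nonneg (hn.1 k).le (hadjnn k i)
      linarith
  -- By `hle` every neighbour contributes at most -n(j)/2, while the terms of a convergent sum tend
  -- to 0 along the cofinite filter.
  have hnb : {i | ∃ γ, T.Joins γ i j}.Finite := by
    have ht := (hn.2 j).summable.tendsto_cofinite_zero
    have hev := ht.eventually (lt_mem_nhds (show -(n j / 2) < 0 by linarith [hn.1 j]))
    refine Set.Finite.subset (Filter.eventually_cofinite.1 hev) ?_
    rintro i ⟨γ, h⟩
    simp only [Set.mem_ofPred_eq, not_lt, cartan, if_neg (h.ne hloop)]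
    push_cast
    have := mul_le_mul_of_nonneg_left (hadjpos i j γ h) (hn.1 i).le
    linarith [hle i γ h]
  have hE : {γ | T.src γ = j ∨ T.tgt γ = j}.Finite := by
    refine Set.Finite.subset (hnb.biUnion fun i _ => hfin i j) ?_
    intro γ hγ
    have h := (joins_other (T := T) (γ := γ) hγ).symm
    simp only [Set.mem_iUnion]
    exact ⟨_, ⟨γ, h⟩, h⟩
  refine ⟨hE.toFinset, by simp, ?_⟩
  have hmaps : ∀ γ ∈ hE.toFinset, T.other γ j ∈ hnb.toFinset := by
    intro γ hγ
    simp only [Set.Finite.mem_toFinset, Set.mem_ofPred_eq] at hγ ⊢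
    exact ⟨γ, (joins_other hγ).symm⟩
  -- Grouping the edges by their other endpoint recovers the multiplicities a_ij.
  rw [← Finset.sum_fiberwise_of_maps_to hmaps]
  have hfib : ∀ i ∈ hnb.toFinset,
      ∑ γ ∈ hE.toFinset with T.other γ j = i, n (T.other γ j) = n i * (T.adjacency i j : ℚ) := by
    intro i _
    rw [Finset.sum_congr rfl (g := fun _ => n i)
      (fun γ hγ => by rw [(Finset.mem_filter.1 hγ).2]), Finset.sum_const, nsmul_eq_mul,
      adjacency_eq hloop hfin hlaced, mul_comm]
    congr 1
    rw [← Set.ncard_coe_finset, Int.cast_natCast, Nat.cast_inj]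
    congr 1
    ext γ
    simp only [Finset.coe_filter, Set.Finite.mem_toFinset, Set.mem_ofPred_eq]
    constructor
    · rintro ⟨h1, rfl⟩
      exact (joins_other h1).symm
    · intro h
      exact ⟨h.symm.incident, h.symm.other_eq (h.ne hloop).symm⟩
  rw [Finset.sum_congr rfl hfib]
  have hj : j ∉ hnb.toFinset := by
    simp only [Set.Finite.mem_toFinset, Set.mem_ofPred_eq, not_exists]
    exact fun γ h => h.ne hloop rfl
  have hsum := (hn.2 j).unique (hasSum_sum_of_ne_finset_zero (s := insert j hnb.toFinset) ?_)
  · rw [Finset.sum_insert hj] at hsum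
    simp only [cartan, if_true, hself] at hsum
    rw [Finset.sum_congr rfl (g := fun i => - (n i * (T.adjacency i j : ℚ)))] at hsum
    · rw [Finset.sum_neg_distrib] at hsum
      push_cast at hsum
      linarith
    · intro i hi
      have : i ≠ j := fun h => hj (h ▸ hi)
      simp [this]
  · intro i hi
    simp only [Finset.mem_insert, Set.Finite.mem_toFinset, Set.mem_ofPred_eq, not_or] at hi
    have : {γ | T.Joins γ i j} = ∅ := Set.eq_empty_of_forall_notMem fun γ h => hi.2 ⟨γ, h⟩
    simp [cartan, hi.1, adjacency_eq hloop hfin hlaced, this]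

/-! ### Saturated copies of a model graph, and cycles -/

/-- By `hsat` no edge leaves the image of `f`, so connectedness makes `f` surjective, and then `g`
too. -/
theorem nonempty_iso_of_saturated {T : LabelledGraph.{u, v}} (hlaced : T.IsSimplyLaced)
    (hconn : T.underlying.Connected) {V E : Type} [Nonempty V] {s t : E → V}
    (f : V → T.V) (g : E → T.E) (hf : Function.Injective f) (hg : Function.Injective g)
    (hfg : ∀ e, T.Joins (g e) (f (s e)) (f (t e)))
    (hsat : ∀ v γ, (T.src γ = f v ∨ T.tgt γ = f v) → ∃ e, g e = γ) :
    Nonempty (Iso T (simplyLaced s t)) := by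
  have hstep : ∀ i j, i ∈ Set.range f → T.underlying.Adj i j → j ∈ Set.range f := by
    rintro _ j ⟨v, rfl⟩ h
    have : ∃ γ, T.Joins γ (f v) j := by
      simp only [underlying, SimpleGraph.fromRel_adj] at h
      rcases h with ⟨-, ⟨γ, h⟩ | ⟨γ, h⟩⟩
      exacts [⟨γ, h⟩, ⟨γ, h.symm⟩]
    obtain ⟨γ, hγ⟩ := this
    obtain ⟨e, rfl⟩ := hsat v γ hγ.incident
    have h1 := hfg e
    rcases hγ with ⟨-, rfl⟩ | ⟨rfl, -⟩ <;> rcases h1 with ⟨a, b⟩ | ⟨a, b⟩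
    exacts [⟨_, b.symm⟩, ⟨_, b.symm⟩, ⟨_, a.symm⟩, ⟨_, a.symm⟩]
  have hfs : Function.Surjective f := by
    intro j
    obtain ⟨p⟩ := hconn.preconnected (f (Classical.arbitrary V)) j
    have : ∀ {a b : T.V} (p : T.underlying.Walk a b), a ∈ Set.range f → b ∈ Set.range f := by
      intro a b p
      induction p with
      | nil => exact id
      | cons h _ ih => exact fun ha => ih (hstep _ _ ha h)
    exact this p ⟨_, rfl⟩
  have hgs : Function.Surjective g := fun γ => by
    obtain ⟨v, hv⟩ := hfs (T.src γ)
    exact hsat v γ (Or.inl hv.symm)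
  let F := Equiv.ofBijective f ⟨hf, hfs⟩
  let G := Equiv.ofBijective g ⟨hg, hgs⟩
  refine ⟨⟨F.symm, G.symm, fun γ => ?_⟩⟩
  obtain ⟨e, rfl⟩ := G.surjective γ
  have hG : G.symm (G e) = e := G.symm_apply_apply e
  have hF : ∀ v, F.symm (f v) = v := fun v => F.symm_apply_apply v
  rcases hfg e with ⟨h1, h2⟩ | ⟨h1, h2⟩
  · left
    refine ⟨?_, ?_, (hlaced _).symm⟩
    · change s (G.symm (G e)) = F.symm (T.src (g e)); rw [h1, hF, hG]
    · change t (G.symm (G e)) = F.symm (T.tgt (g e)); rw [h2, hF, hG]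
  · right
    refine ⟨?_, ?_, by rw [hlaced]; rfl⟩
    · change s (G.symm (G e)) = F.symm (T.tgt (g e)); rw [h2, hF, hG]
    · change t (G.symm (G e)) = F.symm (T.src (g e)); rw [h1, hF, hG]

/-- The inequalities n(k+1) + n(k-1) ≤ 2n(k) add up around the cycle to an equality, so all are
sharp. Counting edges rather than neighbours lets the two-node cycle be treated alike. -/
theorem nonempty_iso_affineA {T : LabelledGraph.{u, v}} (hloop : T.Loopless)
    (hlaced : T.IsSimplyLaced) (hconn : T.underlying.Connected) {n : T.V → ℚ}
    (hn : T.IsBalanced n) {m : ℕ} (hm : 1 ≤ m) (f : Fin (m + 1) → T.V) (g : Fin (m + 1) → T.E)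
    (hf : Function.Injective f) (hg : Function.Injective g)
    (hfg : ∀ k, T.Joins (g k) (f k) (f (k + 1))) : Nonempty (Iso T (affineA m)) := by
  classical
  have hfg' : ∀ k, T.Joins (g (k - 1)) (f k) (f (k - 1)) := fun k => by
    have := (hfg (k - 1)).symm
    rwa [sub_add_cancel] at this
  have hne : ∀ k : Fin (m + 1), g k ≠ g (k - 1) := fun k h => by
    have h1 : (1 : Fin (m + 1)) = 0 := sub_eq_self.1 (hg h).symm
    have := congrArg Fin.val h1
    rw [Fin.val_one', Fin.val_zero, Nat.mod_eq_of_lt (by omega)] at this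
    omega
  have hinc : ∀ k, ∀ γ ∈ ({g k, g (k - 1)} : Finset T.E), T.src γ = f k ∨ T.tgt γ = f k := by
    intro k γ hγ
    simp only [Finset.mem_insert, Finset.mem_singleton] at hγ
    rcases hγ with rfl | rfl
    exacts [(hfg k).incident, (hfg' k).incident]
  have hval : ∀ k, ∑ γ ∈ ({g k, g (k - 1)} : Finset T.E), n (T.other γ (f k)) =
      n (f (k + 1)) + n (f (k - 1)) := fun k => by
    rw [Finset.sum_pair (hne k), (hfg k).other_eq ((hfg k).ne hloop),
      (hfg' k).other_eq ((hfg' k).ne hloop)]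
  have hle : ∀ k ∈ Finset.univ, n (f (k + 1)) + n (f (k - 1)) ≤ 2 * n (f k) := fun k _ => by
    rw [← hval]; exact hn.sum_le (hinc k)
  -- Both shifts permute the cycle.
  have hsum : ∑ k, (n (f (k + 1)) + n (f (k - 1))) = ∑ k, 2 * n (f k) := by
    rw [Finset.sum_add_distrib, ← Finset.mul_sum, two_mul]
    congr 1
    · exact Equiv.sum_comp (Equiv.addRight (1 : Fin (m + 1))) fun k => n (f k)
    · exact Equiv.sum_comp (Equiv.subRight (1 : Fin (m + 1))) fun k => n (f k)
  have heq := (Finset.sum_eq_sum_iff_of_le hle).1 hsum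
  refine nonempty_iso_of_saturated hlaced hconn f g hf hg hfg fun k γ hγ => ?_
  have := hn.mem_of_le_sum (hinc k) (by rw [hval, heq k (Finset.mem_univ k)]) hγ
  simp only [Finset.mem_insert, Finset.mem_singleton] at this
  rcases this with h | h
  exacts [⟨_, h.symm⟩, ⟨_, h.symm⟩]

/-- At most one edge joins two given nodes. -/
def NoMultipleEdges (T : LabelledGraph.{u, v}) : Prop :=
  ∀ γ γ' i j, T.Joins γ i j → T.Joins γ' i j → γ = γ'

theorem nonempty_iso_of_not_noMultipleEdges {T : LabelledGraph.{u, v}} (hloop : T.Loopless)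
    (hlaced : T.IsSimplyLaced) (hconn : T.underlying.Connected) {n : T.V → ℚ}
    (hn : T.IsBalanced n) (h : ¬ T.NoMultipleEdges) : Nonempty (Iso T (affineA 1)) := by
  simp only [NoMultipleEdges, not_forall] at h
  obtain ⟨γ, γ', i, j, h1, h2, h3⟩ := h
  refine nonempty_iso_affineA hloop hlaced hconn hn le_rfl ![i, j] ![γ, γ'] ?_ ?_ ?_
  · intro a b
    have := h1.ne hloop
    fin_cases a <;> fin_cases b <;> simp [this, this.symm]
  · intro a b
    fin_cases a <;> fin_cases b <;> simp [h3, Ne.symm h3]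
  · intro k
    fin_cases k
    · exact h1
    · exact h2.symm

theorem nonempty_iso_of_not_isAcyclic {T : LabelledGraph.{u, v}} (hloop : T.Loopless)
    (hlaced : T.IsSimplyLaced) (hconn : T.underlying.Connected) {n : T.V → ℚ}
    (hn : T.IsBalanced n) (h : ¬ T.underlying.IsAcyclic) :
    ∃ m, 1 ≤ m ∧ Nonempty (Iso T (affineA m)) := by
  simp only [SimpleGraph.IsAcyclic, not_forall, not_not] at h
  obtain ⟨v, p, hp⟩ := h
  have hlen := hp.three_le_length
  obtain ⟨m, hm⟩ : ∃ m, p.length = m + 1 := ⟨p.length - 1, by omega⟩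
  have hsucc : ∀ k : Fin (m + 1), p.getVert ((k + 1 : Fin (m + 1)) : ℕ) = p.getVert (k + 1) := by
    intro k
    rcases eq_or_ne (k : ℕ) m with hk | hk
    · have : k = Fin.last m := Fin.ext hk
      subst this
      simp [← hm]
    · rw [Fin.val_add_one_of_lt' (by omega)]
  have hinj : ∀ a b : ℕ, a < m + 1 → b < m + 1 → p.getVert a = p.getVert b → a = b := by
    intro a b ha hb hab
    exact hp.getVert_injOn' (by simp; omega) (by simp; omega) hab
  have hf : Function.Injective fun k : Fin (m + 1) => p.getVert k := fun a b hab =>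
    Fin.ext (hinj _ _ a.2 b.2 hab)
  have hadj : ∀ k : Fin (m + 1), ∃ γ, T.Joins γ (p.getVert k) (p.getVert ((k + 1 : Fin (m + 1)))) :=
    fun k => by
      rw [hsucc, ← underlying_adj hloop]
      exact p.adj_getVert_succ (by omega)
  choose g hg using hadj
  refine ⟨m, by omega, nonempty_iso_affineA hloop hlaced hconn hn (by omega)
    (fun k => p.getVert k) g hf ?_ hg⟩
  intro a b hab
  have h1 := hg a
  have h2 := hg b
  rw [hab] at h1
  have key : a = b ∨ (a = b + 1 ∧ a + 1 = b) := by
    rcases h1 with ⟨c, d⟩ | ⟨c, d⟩ <;> rcases h2 with ⟨c', d'⟩ | ⟨c', d'⟩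
    · exact Or.inl (hf (c.symm.trans c'))
    · exact Or.inr ⟨hf (c.symm.trans c'), hf (d.symm.trans d')⟩
    · exact Or.inr ⟨hf (d.symm.trans d'), hf (c.symm.trans c')⟩
    · exact Or.inl (hf (d.symm.trans d'))
  rcases key with h | ⟨h, h'⟩
  · exact h
  -- Here an edge is traversed in both directions, which gives 2 = 0 modulo m + 1; but a cycle of a
  -- simple graph has m + 1 ≥ 3.
  · exfalso
    rw [h, add_assoc, add_eq_left] at h'
    have := congrArg Fin.val h'
    rw [Fin.val_add, Fin.val_one', Fin.val_zero, Nat.mod_eq_of_lt (a := 1) (by omega),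
      Nat.mod_eq_of_lt (by omega)] at this
    omega

/-- Edges of `T` are determined by their endpoints, so only nodes need to be embedded. The model has
no multiple edges by `hD`, which makes the induced map on edges injective. -/
theorem nonempty_iso_of_noMultipleEdges {T : LabelledGraph.{u, v}} (hloop : T.Loopless)
    (hlaced : T.IsSimplyLaced) (hconn : T.underlying.Connected) (hT : T.NoMultipleEdges)
    {V E : Type} [Nonempty V] {s t : E → V}
    (f : V → T.V) (hf : Function.Injective f)
    (hD : ∀ e e', s(s e, t e) = s(s e', t e') → e = e')
    (hadj : ∀ e, T.underlying.Adj (f (s e)) (f (t e)))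
    (hsat : ∀ v w, T.underlying.Adj (f v) w →
      ∃ e, (s e = v ∧ f (t e) = w) ∨ (t e = v ∧ f (s e) = w)) :
    Nonempty (Iso T (simplyLaced s t)) := by
  simp only [underlying_adj hloop] at hadj
  choose g hg using hadj
  refine nonempty_iso_of_saturated hlaced hconn f g hf ?_ hg ?_
  · intro e e' hee
    apply hD
    have h1 := hg e
    have h2 := hg e'
    rw [hee] at h1
    rw [Sym2.eq_iff]
    rcases h1 with ⟨c, d⟩ | ⟨c, d⟩ <;> rcases h2 with ⟨c', d'⟩ | ⟨c', d'⟩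
    · exact Or.inl ⟨hf (c.symm.trans c'), hf (d.symm.trans d')⟩
    · exact Or.inr ⟨hf (c.symm.trans c'), hf (d.symm.trans d')⟩
    · exact Or.inr ⟨hf (d.symm.trans d'), hf (c.symm.trans c')⟩
    · exact Or.inl ⟨hf (d.symm.trans d'), hf (c.symm.trans c')⟩
  · intro v γ hγ
    have hj := joins_other hγ
    obtain ⟨e, ⟨rfl, h⟩ | ⟨rfl, h⟩⟩ := hsat v _ ((underlying_adj hloop).2 ⟨γ, hj⟩)
    · exact ⟨e, hT _ _ _ _ (hg e) (h ▸ hj)⟩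
    · exact ⟨e, hT _ _ _ _ (hg e).symm (h ▸ hj)⟩

theorem IsBalanced.exists_neighbors {T : LabelledGraph.{u, v}} (hloop : T.Loopless)
    (hT : T.NoMultipleEdges) {n : T.V → ℚ} (hn : T.IsBalanced n) (j : T.V) :
    ∃ W : Finset T.V, (∀ i, i ∈ W ↔ T.underlying.Adj j i) ∧ ∑ i ∈ W, n i = 2 * n j := by
  classical
  obtain ⟨S, h1, h2⟩ := hn.2 j
  refine ⟨S.image fun γ => T.other γ j, fun i => ?_, ?_⟩
  · rw [underlying_adj hloop]
    simp only [Finset.mem_image, h1]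
    constructor
    · rintro ⟨γ, h, rfl⟩
      exact ⟨γ, joins_other h⟩
    · rintro ⟨γ, h⟩
      exact ⟨γ, h.incident, h.other_eq (h.ne hloop)⟩
  · rw [Finset.sum_image, h2]
    intro γ hγ γ' hγ' h
    have a := joins_other ((h1 _).1 hγ)
    have b := joins_other ((h1 _).1 hγ')
    simp only at h
    rw [← h] at b
    exact hT _ _ _ _ a b

end LabelledGraph

/-- A concave sequence that does not increase in its first step and does not decrease in its last
step is constant. -/
theorem eq_of_concave_of_endpoints {a : ℕ → ℚ} {l : ℕ} (hfirst : 0 < l → a 1 ≤ a 0)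
    (hlast : 0 < l → a (l - 1) ≤ a l) (hconc : ∀ i, i + 2 ≤ l → a i + a (i + 2) ≤ 2 * a (i + 1)) :
    ∀ i ≤ l, a i = a 0 := by
  have hdown : ∀ i, i + 1 ≤ l → a (i + 1) ≤ a i := by
    intro i
    induction i with
    | zero => exact fun h => hfirst h
    | succ i ih => exact fun h => by linarith [ih (by omega), hconc i h]
  -- Downward induction: `j` counts the steps left after `i + 1`.
  have hup : ∀ j i, i + j + 1 = l → a i ≤ a (i + 1) := by
    intro j
    induction j with
    | zero =>
      intro i h
      have := hlast (by omega)
      rwa [← h, add_zero, Nat.add_sub_cancel] at this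
    | succ j ih => exact fun i h => by linarith [ih (i + 1) (by omega), hconc i (by omega)]
  intro i
  induction i with
  | zero => exact fun _ => rfl
  | succ i ih =>
    intro h
    rw [← ih (by omega)]
    exact le_antisymm (hdown i h) (hup (l - 1 - i) i (by omega))

/-! ### Non-backtracking sequences in acyclic graphs -/

namespace SimpleGraph

/-- The first `k` steps of `h` follow edges of `G` and never return at once to the previous node. -/
def IsNonbacktracking {V : Type u} (G : SimpleGraph V) (h : ℕ → V) (k : ℕ) : Prop :=
  (∀ i < k, G.Adj (h i) (h (i + 1))) ∧ ∀ i, i + 2 ≤ k → h i ≠ h (i + 2)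

namespace IsNonbacktracking

variable {V : Type u} {G : SimpleGraph V} {h : ℕ → V}

theorem mono {k l : ℕ} (hk : G.IsNonbacktracking h k) (hl : l ≤ k) : G.IsNonbacktracking h l :=
  ⟨fun i hi => hk.1 i (by omega), fun i hi => hk.2 i (by omega)⟩

theorem one (h01 : G.Adj (h 0) (h 1)) : G.IsNonbacktracking h 1 :=
  ⟨fun i hi => by obtain rfl : i = 0 := by omega
                  exact h01, fun i hi => by omega⟩

theorem succ {k : ℕ} (hk : G.IsNonbacktracking h (k + 1)) (hadj : G.Adj (h (k + 1)) (h (k + 2)))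
    (hne : h k ≠ h (k + 2)) : G.IsNonbacktracking h (k + 2) := by
  refine ⟨fun i hi => ?_, fun i hi => ?_⟩
  · rcases Nat.lt_succ_iff_lt_or_eq.1 hi with hi | rfl
    exacts [hk.1 i hi, hadj]
  · rcases Nat.lt_or_ge i k with hi' | hi'
    · exact hk.2 i (by omega)
    · obtain rfl : i = k := by omega
      exact hne

/-- In an acyclic graph a neighbour of the end of a path that already lies on the path is its
penultimate node; non-backtracking excludes exactly this. -/
theorem exists_isPath (hG : G.IsAcyclic) : ∀ k, G.IsNonbacktracking h (k + 1) →
    ∃ p : G.Walk (h 0) (h (k + 1)), p.IsPath ∧ p.length = k + 1 ∧ p.penultimate = h k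
  | 0, hk => ⟨(hk.1 0 (by omega)).toWalk, by simp [(hk.1 0 (by omega)).ne], by simp, by simp⟩
  | k + 1, hk => by
    obtain ⟨p, hp, hl, hpen⟩ := exists_isPath hG k (hk.mono (by omega))
    have hadj := hk.1 (k + 1) (by omega)
    refine ⟨p.concat hadj, hp.concat (fun hmem => ?_) hadj, by simp [hl], by simp⟩
    have := hG.eq_penultimate_of_adj_end hp hadj hmem
    exact hk.2 k le_rfl (hpen.symm.trans this.symm)

theorem zero_ne (hG : G.IsAcyclic) {k : ℕ} (hk : G.IsNonbacktracking h k) (hpos : 0 < k) :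
    h 0 ≠ h k := by
  obtain ⟨k, rfl⟩ := Nat.exists_eq_succ_of_ne_zero hpos.ne'
  obtain ⟨p, hp, hl, -⟩ := exists_isPath hG k hk
  intro heq
  have : (p.copy rfl heq.symm).length = 0 :=
    Walk.length_eq_zero_iff.2 (Walk.isPath_iff_nil.1 ((Walk.isPath_copy _ _ _).2 hp))
  rw [Walk.length_copy, hl] at this
  omega

theorem eq_of_eq (hG : G.IsAcyclic) {k : ℕ} (hk : G.IsNonbacktracking h k) {i j : ℕ} (hi : i ≤ k)
    (hj : j ≤ k) (hij : h i = h j) : i = j := by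
  have key : ∀ i j, i < j → j ≤ k → h i ≠ h j := by
    intro i j hij hj
    have : G.IsNonbacktracking (fun m => h (i + m)) (j - i) :=
      ⟨fun m hm => hk.1 (i + m) (by omega), fun m hm => hk.2 (i + m) (by omega)⟩
    have := this.zero_ne hG (by omega)
    rwa [add_zero, Nat.add_sub_cancel' hij.le] at this
  rcases lt_trichotomy i j with h' | h' | h'
  · exact absurd hij (key _ _ h' hj)
  · exact h'
  · exact absurd hij.symm (key _ _ h' hi)

/-- Running `h` backwards to the common start and then along `h'` does not backtrack, because the
first steps differ; so its two ends cannot coincide. -/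
theorem eq_zero_of_eq (hG : G.IsAcyclic) {h' : ℕ → V} {k l : ℕ} (hk : G.IsNonbacktracking h k)
    (hl : G.IsNonbacktracking h' l) (h0 : h 0 = h' 0) (h1 : h 1 ≠ h' 1) (heq : h k = h' l) :
    k = 0 ∧ l = 0 := by
  rcases Nat.eq_zero_or_pos k with rfl | hkpos
  · exact ⟨rfl, (hl.eq_of_eq hG (Nat.zero_le _) le_rfl (h0.symm.trans heq)).symm⟩
  rcases Nat.eq_zero_or_pos l with rfl | hlpos
  · exact ⟨hk.eq_of_eq hG le_rfl (Nat.zero_le _) (heq.trans h0.symm), rfl⟩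
  exfalso
  let q : ℕ → V := fun m => if m ≤ k then h (k - m) else h' (m - k)
  have q1 : ∀ m, m ≤ k → q m = h (k - m) := fun m hm => if_pos hm
  have q2 : ∀ m, k ≤ m → q m = h' (m - k) := fun m hm => by
    rcases eq_or_lt_of_le hm with rfl | hm
    · rw [q1 _ le_rfl, Nat.sub_self, h0]
    · exact if_neg (by omega)
  have hq : G.IsNonbacktracking q (k + l) := by
    refine ⟨fun i hi => ?_, fun i hi => ?_⟩
    · rcases Nat.lt_or_ge i k with hik | hik
      · rw [q1 i (by omega), q1 (i + 1) (by omega)]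
        have := hk.1 (k - (i + 1)) (by omega)
        rw [show k - (i + 1) + 1 = k - i by omega] at this
        exact this.symm
      · rw [q2 i (by omega), q2 (i + 1) (by omega)]
        have := hl.1 (i - k) (by omega)
        rwa [show i - k + 1 = i + 1 - k by omega] at this
    · rcases Nat.lt_or_ge (i + 1) k with hik | hik
      · rw [q1 i (by omega), q1 (i + 2) (by omega)]
        have := hk.2 (k - (i + 2)) (by omega)
        rw [show k - (i + 2) + 2 = k - i by omega] at this
        exact this.symm
      · rcases eq_or_lt_of_le hik with hik | hik
        · rw [q1 i (by omega), q2 (i + 2) (by omega), show k - i = 1 by omega,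
            show i + 2 - k = 1 by omega]
          exact h1
        · rw [q2 i (by omega), q2 (i + 2) (by omega)]
          have := hl.2 (i - k) (by omega)
          rwa [show i - k + 2 = i + 2 - k by omega] at this
  have := hq.zero_ne hG (by omega)
  rw [q1 0 (Nat.zero_le _), q2 (k + l) (by omega), Nat.sub_zero, Nat.add_sub_cancel_left] at this
  exact this heq

end IsNonbacktracking

/-! ### Positive harmonic functions -/

/-- `G` is locally finite, `n` is positive, and `2 * n v` is the sum of `n` over the neighbours
of `v`. -/
def IsHarmonic {V : Type u} (G : SimpleGraph V) (n : V → ℚ) : Prop :=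
  (∀ v, 0 < n v) ∧ ∀ v, ∃ W : Finset V, (∀ w, w ∈ W ↔ G.Adj v w) ∧ ∑ w ∈ W, n w = 2 * n v

namespace IsHarmonic

variable {V : Type u} {G : SimpleGraph V} {n : V → ℚ}

/-- Every omitted neighbour has a positive value. Sharpness of the inequality thus becomes a
statement on the graph, and conversely. -/
theorem sum_le (hn : G.IsHarmonic n) {v : V} {S : Finset V} (hS : ∀ w ∈ S, G.Adj v w) :
    ∑ w ∈ S, n w ≤ 2 * n v ∧ (2 * n v ≤ ∑ w ∈ S, n w ↔ ∀ x, G.Adj v x → x ∈ S) := by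
  classical
  obtain ⟨W, hW, hsum⟩ := hn.2 v
  have hSW : S ⊆ W := fun w hw => (hW w).2 (hS w hw)
  have hle : ∑ w ∈ S, n w ≤ ∑ w ∈ W, n w :=
    Finset.sum_le_sum_of_subset_of_nonneg hSW fun _ _ _ => (hn.1 _).le
  rw [← hsum]
  refine ⟨hle, fun h x hx => ?_, fun h => ?_⟩
  · by_contra hxS
    exact absurd h (not_le.2 (Finset.sum_lt_sum_of_subset hSW ((hW x).2 hx) hxS (hn.1 x)
      fun _ _ _ => (hn.1 _).le))
  · rw [Finset.Subset.antisymm hSW fun x hx => h x ((hW x).1 hx)]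

theorem one (hn : G.IsHarmonic n) {v a : V} (ha : G.Adj v a) :
    n a ≤ 2 * n v ∧ (2 * n v ≤ n a ↔ ∀ x, G.Adj v x → x = a) := by
  have := hn.sum_le (v := v) (S := {a}) (by simpa using ha)
  simpa using this

theorem two (hn : G.IsHarmonic n) {v a b : V} (ha : G.Adj v a) (hb : G.Adj v b) (hab : a ≠ b) :
    n a + n b ≤ 2 * n v ∧ (2 * n v ≤ n a + n b ↔ ∀ x, G.Adj v x → x = a ∨ x = b) := by
  classical
  have := hn.sum_le (v := v) (S := {a, b}) (by simp [ha, hb])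
  simpa [Finset.sum_pair hab] using this

theorem three (hn : G.IsHarmonic n) {v a b c : V} (ha : G.Adj v a) (hb : G.Adj v b)
    (hc : G.Adj v c) (hab : a ≠ b) (hac : a ≠ c) (hbc : b ≠ c) :
    n a + n b + n c ≤ 2 * n v ∧
      (2 * n v ≤ n a + n b + n c ↔ ∀ x, G.Adj v x → x = a ∨ x = b ∨ x = c) := by
  classical
  have := hn.sum_le (v := v) (S := {a, b, c}) (by simp [ha, hb, hc])
  rw [Finset.sum_insert (by simp [hab, hac]), Finset.sum_pair hbc] at this
  simpa [add_assoc] using this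

theorem four (hn : G.IsHarmonic n) {v a b c d : V} (ha : G.Adj v a) (hb : G.Adj v b)
    (hc : G.Adj v c) (hd : G.Adj v d) (hab : a ≠ b) (hac : a ≠ c) (had : a ≠ d) (hbc : b ≠ c)
    (hbd : b ≠ d) (hcd : c ≠ d) :
    n a + n b + n c + n d ≤ 2 * n v ∧
      (2 * n v ≤ n a + n b + n c + n d ↔ ∀ x, G.Adj v x → x = a ∨ x = b ∨ x = c ∨ x = d) := by
  classical
  have := hn.sum_le (v := v) (S := {a, b, c, d}) (by simp [ha, hb, hc, hd])
  rw [Finset.sum_insert (by simp [hab, hac, had]), Finset.sum_insert (by simp [hbc, hbd]),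
    Finset.sum_pair hcd] at this
  simpa [add_assoc] using this

theorem exists_adj (hn : G.IsHarmonic n) (v : V) : ∃ x, G.Adj v x := by
  by_contra! h
  have := (hn.sum_le (v := v) (S := ∅) (by simp)).2.2 fun x hx => absurd hx (h x)
  simp only [Finset.sum_empty] at this
  linarith [hn.1 v]

end IsHarmonic

/-! ### Arms -/

/-- As long as `h` does not backtrack, its nodes after `h 0` have no neighbours outside `h`, and
`h` goes on unless it has reached an end node. -/
structure IsArm {V : Type u} (G : SimpleGraph V) (h : ℕ → V) : Prop where
  adj : G.Adj (h 0) (h 1)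
  step : ∀ i, G.IsNonbacktracking h (i + 1) → (∀ x, G.Adj (h (i + 1)) x → x = h i) ∨
    (G.IsNonbacktracking h (i + 2) ∧ ∀ x, G.Adj (h (i + 1)) x → x = h i ∨ x = h (i + 2))

/-- The arm `h` ends with the node `h (p + 1)`. -/
def EndsAt {V : Type u} (G : SimpleGraph V) (h : ℕ → V) (p : ℕ) : Prop :=
  G.IsNonbacktracking h (p + 1) ∧ ∀ x, G.Adj (h (p + 1)) x → x = h p

/-- `v` has at least three neighbours. -/
def IsBranch {V : Type u} (G : SimpleGraph V) (v : V) : Prop :=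
  ∃ a b c, G.Adj v a ∧ G.Adj v b ∧ G.Adj v c ∧ a ≠ b ∧ a ≠ c ∧ b ≠ c

section arms

variable {V : Type u} {G : SimpleGraph V}

theorem eq_or_eq_of_not_isBranch {v a b x : V} (hv : ¬ G.IsBranch v) (ha : G.Adj v a)
    (hb : G.Adj v b) (hab : a ≠ b) (hx : G.Adj v x) : x = a ∨ x = b := by
  by_contra! h
  exact hv ⟨a, b, x, ha, hb, hx, hab, h.1.symm, h.2.symm⟩

theorem IsBranch.exists_avoiding {v : V} (hv : G.IsBranch v) (z : V) :
    ∃ x y, G.Adj v x ∧ G.Adj v y ∧ x ≠ y ∧ x ≠ z ∧ y ≠ z := by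
  obtain ⟨a, b, c, ha, hb, hc, hab, hac, hbc⟩ := hv
  by_cases h1 : a = z
  · exact ⟨b, c, hb, hc, hbc, h1 ▸ hab.symm, h1 ▸ hac.symm⟩
  · by_cases h2 : b = z
    · exact ⟨a, c, ha, hc, hac, h1, h2 ▸ hbc.symm⟩
    · exact ⟨a, b, ha, hb, hab, h1, h2⟩

/-- At an end node `next` turns back, so the total sequence `h` stops being non-backtracking there;
its later values are never used. Acyclicity keeps `h` from returning to `c`, the only node allowed
to branch. -/
theorem exists_isArm (hG : G.IsAcyclic) {c x : V} (hcx : G.Adj c x)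
    (hbr : ∀ v, v ≠ c → ¬ G.IsBranch v) : ∃ h : ℕ → V, h 0 = c ∧ h 1 = x ∧ G.IsArm h := by
  classical
  let next : V → V → V := fun a b => if hw : ∃ w, G.Adj b w ∧ w ≠ a then hw.choose else a
  let pair : ℕ → V × V := fun i => Nat.rec (c, x) (fun _ p => (p.2, next p.1 p.2)) i
  let h : ℕ → V := fun i => (pair i).1
  have hnext : ∀ i, h (i + 2) = next (h i) (h (i + 1)) := fun i => rfl
  have h01 : G.Adj (h 0) (h 1) := hcx
  refine ⟨h, rfl, rfl, h01, fun i hi => ?_⟩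
  by_cases hw : ∃ w, G.Adj (h (i + 1)) w ∧ w ≠ h i
  · right
    have e : h (i + 2) = hw.choose := (hnext i).trans (dif_pos hw)
    have hadj : G.Adj (h (i + 1)) (h (i + 2)) := e ▸ hw.choose_spec.1
    have hne : h i ≠ h (i + 2) := (e ▸ hw.choose_spec.2 : h (i + 2) ≠ h i).symm
    refine ⟨hi.succ hadj hne, fun x hx => eq_or_eq_of_not_isBranch (hbr _ fun hc => ?_)
      (hi.1 i (by omega)).symm hadj hne hx⟩
    have := hi.eq_of_eq hG le_rfl (Nat.zero_le _) (hc : h (i + 1) = h 0)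
    omega
  · left
    intro x hx
    by_contra hne
    exact hw ⟨x, hx, hne⟩

variable {h : ℕ → V} {n : V → ℚ}

theorem IsArm.isNonbacktracking_or_endsAt (hh : G.IsArm h) (k : ℕ) :
    G.IsNonbacktracking h (k + 1) ∨ ∃ p < k, G.EndsAt h p := by
  induction k with
  | zero => exact Or.inl (.one hh.adj)
  | succ k ih =>
    rcases ih with ih | ⟨p, hp, hp'⟩
    · rcases hh.step k ih with h1 | h1
      · exact Or.inr ⟨k, by omega, ih, h1⟩
      · exact Or.inl h1.1
    · exact Or.inr ⟨p, by omega, hp'⟩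

theorem IsArm.forall_isNonbacktracking (hh : G.IsArm h) (hend : ∀ p, ¬ G.EndsAt h p) (k : ℕ) :
    G.IsNonbacktracking h k :=
  ((hh.isNonbacktracking_or_endsAt k).resolve_right fun ⟨p, _, hp⟩ => hend p hp).mono (by omega)

theorem IsArm.eq_or_eq (hh : G.IsArm h) {i : ℕ} (hi : G.IsNonbacktracking h (i + 2)) {x : V}
    (hx : G.Adj (h (i + 1)) x) : x = h i ∨ x = h (i + 2) := by
  rcases hh.step i (hi.mono (by omega)) with h1 | h1
  · exact absurd (h1 _ (hi.1 (i + 1) (by omega))).symm (hi.2 i le_rfl)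
  · exact h1.2 x hx

theorem IsNonbacktracking.add_le (hn : G.IsHarmonic n) {i : ℕ} (hi : G.IsNonbacktracking h (i + 2)) :
    n (h i) + n (h (i + 2)) ≤ 2 * n (h (i + 1)) ∧
      (2 * n (h (i + 1)) ≤ n (h i) + n (h (i + 2)) ↔
        ∀ x, G.Adj (h (i + 1)) x → x = h i ∨ x = h (i + 2)) :=
  hn.two (hi.1 i (by omega)).symm (hi.1 (i + 1) (by omega)) (hi.2 i le_rfl)

/-- An inner node of an arm has just two neighbours, so the second difference of n vanishes there.
-/
theorem IsArm.apply_eq (hh : G.IsArm h) (hn : G.IsHarmonic n) :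
    ∀ k, G.IsNonbacktracking h (k + 1) →
      n (h k) = n (h 0) + k * (n (h 1) - n (h 0)) ∧
        n (h (k + 1)) = n (h 0) + (k + 1) * (n (h 1) - n (h 0))
  | 0, _ => by simp
  | k + 1, hk => by
    obtain ⟨h1, h2⟩ := hh.apply_eq hn k (hk.mono (by omega))
    have h3 := hk.add_le hn
    have h4 := h3.2.2 fun x hx => hh.eq_or_eq hk hx
    push_cast
    exact ⟨h2, by linarith [h3.1]⟩

/-- Balance at the end node acts as if one more node carried the value 0: the affine function along
the arm vanishes at p + 2. -/
theorem IsArm.apply_of_endsAt (hh : G.IsArm h) (hn : G.IsHarmonic n) {p : ℕ} (hp : G.EndsAt h p) :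
    (p + 2) * n (h 1) = (p + 1) * n (h 0) := by
  obtain ⟨h1, h2⟩ := hh.apply_eq hn p hp.1
  have h3 := hn.one (hp.1.1 p (by omega)).symm
  have h4 := h3.2.2 hp.2
  linarith [h3.1]

end arms

/-! ### Stars with three arms, and double forks -/

/-- Three sequences with the same start and distinct first steps. -/
structure IsTripod {V : Type u} (F : Fin 3 → ℕ → V) : Prop where
  center : ∀ i j, F i 0 = F j 0
  first : ∀ i j, F i 1 = F j 1 → i = j

theorem IsTripod.eq_of_eq {V : Type u} {G : SimpleGraph V} {F : Fin 3 → ℕ → V} (hF : IsTripod F)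
    (hG : G.IsAcyclic) {i j : Fin 3} {a b : ℕ} (ha : G.IsNonbacktracking (F i) a)
    (hb : G.IsNonbacktracking (F j) b) (h : F i a = F j b) : (a = 0 ∧ b = 0) ∨ (i = j ∧ a = b) := by
  by_cases hij : i = j
  · subst hij
    right
    rcases le_total a b with hab | hab
    · exact ⟨rfl, hb.eq_of_eq hG hab le_rfl h⟩
    · exact ⟨rfl, ha.eq_of_eq hG le_rfl hab h⟩
  · exact Or.inl (ha.eq_zero_of_eq hG hb (hF.center i j) (fun h => hij (hF.first i j h)) h)

/-- `code` gives a node as an arm and a distance from the centre. Distance 0 means the centre on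
every arm, whence the first alternative in `hinj`. -/
theorem IsTripod.injective {V : Type u} {G : SimpleGraph V} {F : Fin 3 → ℕ → V} (hF : IsTripod F)
    (hG : G.IsAcyclic) {W : Type*} (code : W → Fin 3 × ℕ)
    (hcode : ∀ v, G.IsNonbacktracking (F (code v).1) (code v).2)
    (hinj : ∀ v w, ((code v).2 = 0 ∧ (code w).2 = 0) ∨
      ((code v).1 = (code w).1 ∧ (code v).2 = (code w).2) → v = w) :
    Function.Injective fun v => F (code v).1 (code v).2 := fun v w h =>
  hinj v w (hF.eq_of_eq hG (hcode v) (hcode w) h)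

/-- A tripod of arms whose centre has no further neighbours. -/
structure IsStar {V : Type u} (G : SimpleGraph V) (F : Fin 3 → ℕ → V) : Prop extends IsTripod F where
  arm : ∀ i, G.IsArm (F i)
  center_adj : ∀ x, G.Adj (F 0 0) x → ∃ i, x = F i 1

theorem IsStar.comp {V : Type u} {G : SimpleGraph V} {F : Fin 3 → ℕ → V} (hF : G.IsStar F)
    (σ : Equiv.Perm (Fin 3)) : G.IsStar (F ∘ σ) where
  center i j := hF.center _ _
  first i j h := σ.injective (hF.first _ _ h)
  arm i := hF.arm _
  center_adj x hx := by
    obtain ⟨i, hi⟩ := hF.center_adj x (by rwa [hF.center 0 (σ 0)])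
    exact ⟨σ.symm i, by simpa using hi⟩

theorem IsStar.sum_first_eq {V : Type u} {G : SimpleGraph V} {F : Fin 3 → ℕ → V} (hF : G.IsStar F)
    {n : V → ℚ} (hn : G.IsHarmonic n) : n (F 0 1) + n (F 1 1) + n (F 2 1) = 2 * n (F 0 0) := by
  have hne : ∀ i j, i ≠ j → F i 1 ≠ F j 1 := fun i j hij h => hij (hF.first i j h)
  have hadj : ∀ i, G.Adj (F 0 0) (F i 1) := fun i => hF.center 0 i ▸ (hF.arm i).adj
  have := hn.three (hadj 0) (hadj 1) (hadj 2) (hne 0 1 (by decide)) (hne 0 2 (by decide))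
    (hne 1 2 (by decide))
  refine le_antisymm this.1 (this.2.2 fun x hx => ?_)
  obtain ⟨i, rfl⟩ := hF.center_adj x hx
  fin_cases i <;> simp

/-- Each prong carries at least half the value of its fork node, so along the spine from `q 0` to `q
l` the values do not rise in the first step nor fall in the last. They are also concave, hence
constant, and every inequality used is sharp. -/
theorem IsHarmonic.saturated_of_double_fork {V : Type u} {G : SimpleGraph V}
    {n : V → ℚ} (hn : G.IsHarmonic n) {l : ℕ} {q q' : ℕ → V} {a b : V}
    (hq : G.IsNonbacktracking q (l + 1)) (hq' : G.IsNonbacktracking q' (l + 1))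
    (hqq : ∀ i ≤ l, q' i = q i) (hne : q (l + 1) ≠ q' (l + 1)) (ha : G.Adj (q 0) a)
    (hb : G.Adj (q 0) b) (hab : a ≠ b) (ha1 : a ≠ q 1) (hb1 : b ≠ q 1) (ha1' : a ≠ q' 1)
    (hb1' : b ≠ q' 1) :
    (∀ x, G.Adj a x → x = q 0) ∧ (∀ x, G.Adj b x → x = q 0) ∧
      (∀ x, G.Adj (q (l + 1)) x → x = q l) ∧ (∀ x, G.Adj (q' (l + 1)) x → x = q l) ∧
      ∀ i ≤ l, ∀ x, G.Adj (q i) x → (i = 0 ∧ (x = a ∨ x = b)) ∨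
        (0 < i ∧ x = q (i - 1)) ∨ x = q (i + 1) ∨ (i = l ∧ x = q' (l + 1)) := by
  have hz : G.Adj (q l) (q (l + 1)) := hq.1 l (by omega)
  have hz' : G.Adj (q l) (q' (l + 1)) := hqq l le_rfl ▸ hq'.1 l (by omega)
  have la := hn.one ha.symm
  have lb := hn.one hb.symm
  have lz := hn.one hz.symm
  have lz' := hn.one hz'.symm
  -- For `l = 0` the spine is one node with all four prongs.
  rcases Nat.eq_zero_or_pos l with rfl | hl
  · have h4 := hn.four ha hb hz hz' hab ha1 ha1' hb1 hb1' hne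
    refine ⟨la.2.1 ?_, lb.2.1 ?_, lz.2.1 ?_, lz'.2.1 ?_, fun i hi x hx => ?_⟩
    iterate 4 linarith [h4.1, la.1, lb.1, lz.1, lz'.1]
    obtain rfl : i = 0 := by omega
    rcases h4.2.1 (by linarith [la.1, lb.1, lz.1, lz'.1]) x hx with h | h | h | h
    exacts [.inl ⟨rfl, .inl h⟩, .inl ⟨rfl, .inr h⟩, .inr (.inr (.inl h)),
      .inr (.inr (.inr ⟨rfl, h⟩))]
  have hint : ∀ i, i + 2 ≤ l → n (q i) + n (q (i + 2)) ≤ 2 * n (q (i + 1)) ∧ _ := fun i hi =>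
    (hq.mono (show i + 2 ≤ l + 1 by omega)).add_le hn
  have hstart := hn.three ha hb (hq.1 0 (by omega)) hab ha1 hb1
  have e : l - 1 + 1 = l := by omega
  have h1 := hq.1 (l - 1) (by omega)
  have h2 := hq.2 (l - 1) (by omega)
  have h3 := hq'.2 (l - 1) (by omega)
  rw [e] at h1
  rw [show l - 1 + 2 = l + 1 by omega] at h2 h3
  rw [hqq _ (by omega)] at h3
  have hend := hn.three h1.symm hz hz' h2 h3 hne
  rw [zero_add] at hstart
  have hconst : ∀ i ≤ l, n (q i) = n (q 0) :=
    eq_of_concave_of_endpoints (a := fun i => n (q i))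
      (fun _ => by linarith [hstart.1, la.1, lb.1]) (fun _ => by linarith [hend.1, lz.1, lz'.1])
      fun i hi => (hint i hi).1
  have hl0 := hconst l le_rfl
  have e1 := hconst 1 hl
  have e2 := hconst (l - 1) (by omega)
  refine ⟨la.2.1 ?_, lb.2.1 ?_, lz.2.1 ?_, lz'.2.1 ?_, fun i hi x hx => ?_⟩
  iterate 2 linarith [hstart.1, la.1, lb.1]
  iterate 2 linarith [hend.1, lz.1, lz'.1]
  rcases Nat.eq_zero_or_pos i with rfl | hipos
  · rcases hstart.2.1 (by linarith [la.1, lb.1]) x hx with h | h | h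
    exacts [.inl ⟨rfl, .inl h⟩, .inl ⟨rfl, .inr h⟩, .inr (.inr (.inl h))]
  rcases eq_or_lt_of_le hi with rfl | hil
  · rcases hend.2.1 (by linarith [lz.1, lz'.1]) x hx with h | h | h
    exacts [.inr (.inl ⟨hl, h⟩), .inr (.inr (.inl h)), .inr (.inr (.inr ⟨rfl, h⟩))]
  · obtain ⟨i, rfl⟩ := Nat.exists_eq_succ_of_ne_zero hipos.ne'
    rcases (hint i hil).2.1 (by
      rw [hconst i (by omega), hconst (i + 1) (by omega), hconst (i + 2) (by omega)]
      linarith) x hx with h | h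
    exacts [.inr (.inl ⟨hipos, h⟩), .inr (.inr (.inl h))]

end SimpleGraph

/-! ### Identifying trees with the diagrams -/

namespace LabelledGraph

open SimpleGraph

/-- A connected simply-laced labelled tree with a harmonic function on its nodes. -/
structure IsHarmonicTree (T : LabelledGraph.{u, v}) (n : T.V → ℚ) : Prop where
  loopless : T.Loopless
  laced : T.IsSimplyLaced
  connected : T.underlying.Connected
  simple : T.NoMultipleEdges
  acyclic : T.underlying.IsAcyclic
  harmonic : T.underlying.IsHarmonic n

namespace IsHarmonicTree

variable {T : LabelledGraph.{u, v}} {n : T.V → ℚ}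

theorem nonempty_iso (hT : T.IsHarmonicTree n) {V E : Type} [Nonempty V] {s t : E → V}
    (f : V → T.V) (hf : Function.Injective f)
    (hD : ∀ e e', s(s e, t e) = s(s e', t e') → e = e')
    (hadj : ∀ e, T.underlying.Adj (f (s e)) (f (t e)))
    (hsat : ∀ v w, T.underlying.Adj (f v) w →
      ∃ e, (s e = v ∧ f (t e) = w) ∨ (t e = v ∧ f (s e) = w)) :
    Nonempty (Iso T (simplyLaced s t)) :=
  nonempty_iso_of_noMultipleEdges hT.loopless hT.laced hT.connected hT.simple f hf hD hadj hsat

theorem nonempty_iso_infiniteA (hT : T.IsHarmonicTree n) {h : ℕ → T.V}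
    (hnb : ∀ k, T.underlying.IsNonbacktracking h k) (h0 : ∀ x, T.underlying.Adj (h 0) x → x = h 1)
    (harm : T.underlying.IsArm h) : Nonempty (Iso T infiniteA) := by
  refine hT.nonempty_iso h (fun a b hab => ?_) ?_ (fun k => (hnb (k + 1)).1 k (by omega)) ?_
  · exact (hnb (max a b)).eq_of_eq hT.acyclic (le_max_left _ _) (le_max_right _ _) hab
  · intro e e' h
    rw [Sym2.eq_iff] at h
    omega
  · rintro (_ | k) w hw
    · exact ⟨0, Or.inl ⟨rfl, (h0 w hw).symm⟩⟩
    · rcases harm.eq_or_eq (hnb _) hw with rfl | rfl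
      · exact ⟨k, Or.inr ⟨rfl, rfl⟩⟩
      · exact ⟨k + 1, Or.inl ⟨rfl, rfl⟩⟩

theorem nonempty_iso_biinfiniteA (hT : T.IsHarmonicTree n) {h h' : ℕ → T.V}
    (hnb : ∀ k, T.underlying.IsNonbacktracking h k)
    (hnb' : ∀ k, T.underlying.IsNonbacktracking h' k)
    (harm : T.underlying.IsArm h) (harm' : T.underlying.IsArm h') (h0 : h 0 = h' 0)
    (h1 : h 1 ≠ h' 1) (hc : ∀ x, T.underlying.Adj (h 0) x → x = h 1 ∨ x = h' 1) :
    Nonempty (Iso T biinfiniteA) := by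
  -- The common start belongs to `h`, so the negative half begins with `h' 1`.
  let f : ℤ → T.V := fun k => match k with
    | Int.ofNat k => h k
    | Int.negSucc k => h' (k + 1)
  have hfneg : ∀ k : ℕ, f (-(k : ℤ)) = h' k := by
    rintro (_ | k)
    · exact h0
    · rfl
  refine hT.nonempty_iso f ?_ ?_ ?_ ?_
  · have key : ∀ a b : ℕ, h a = h' (b + 1) → False := fun a b hab => by
      have := ((hnb a).eq_zero_of_eq hT.acyclic (hnb' (b + 1)) h0 h1 hab).2
      omega
    rintro (a | a) (b | b) hab
    · exact congrArg Int.ofNat ((hnb (max a b)).eq_of_eq hT.acyclic (le_max_left _ _)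
        (le_max_right _ _) hab)
    · exact (key _ _ hab).elim
    · exact (key _ _ (Eq.symm hab)).elim
    · have := (hnb' (max a b + 1)).eq_of_eq hT.acyclic (i := a + 1) (j := b + 1)
        (by omega) (by omega) hab
      rw [Nat.succ.inj this]
  · intro e e' h
    rw [Sym2.eq_iff] at h
    omega
  · rintro (k | k)
    · exact (hnb (k + 1)).1 k (by omega)
    · have : (Int.negSucc k : ℤ) + 1 = -(k : ℤ) := by omega
      rw [this, hfneg]
      exact ((hnb' (k + 1)).1 k (by omega)).symm
  · rintro ((_ | k) | k) w hw
    · rcases hc w hw with rfl | rfl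
      · exact ⟨0, Or.inl ⟨rfl, rfl⟩⟩
      · exact ⟨-1, Or.inr ⟨rfl, rfl⟩⟩
    · rcases harm.eq_or_eq (hnb _) hw with rfl | rfl
      · exact ⟨k, Or.inr ⟨rfl, rfl⟩⟩
      · exact ⟨(k + 1 : ℕ), Or.inl ⟨rfl, rfl⟩⟩
    · rcases harm'.eq_or_eq (hnb' _) hw with rfl | rfl
      · refine ⟨Int.negSucc k, Or.inl ⟨rfl, ?_⟩⟩
        have : (Int.negSucc k : ℤ) + 1 = -(k : ℤ) := by omega
        rw [this, hfneg]
      · refine ⟨Int.negSucc (k + 1), Or.inr ⟨by omega, rfl⟩⟩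

theorem nonempty_iso_infiniteD (hT : T.IsHarmonicTree n) {F : Fin 3 → ℕ → T.V}
    (hF : T.underlying.IsStar F) (h0 : T.underlying.EndsAt (F 0) 0)
    (h1 : T.underlying.EndsAt (F 1) 0) : Nonempty (Iso T infiniteD) := by
  -- Two one-node arms carry half the central value each, so the third begins with the full central
  -- value; on a finite arm it would be smaller.
  have hinf : ∀ p, ¬ T.underlying.EndsAt (F 2) p := fun p hp => by
    have e0 := (hF.arm 0).apply_of_endsAt hT.harmonic h0
    have e1 := (hF.arm 1).apply_of_endsAt hT.harmonic h1
    have e2 := (hF.arm 2).apply_of_endsAt hT.harmonic hp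
    have e := hF.sum_first_eq hT.harmonic
    rw [hF.center 1 0] at e1
    rw [hF.center 2 0] at e2
    push_cast at e0 e1
    have e3 : n (F 2 1) = n (F 0 0) := by linarith
    rw [e3] at e2
    linarith [hT.harmonic.1 (F 0 0)]
  have hnb := (hF.arm 2).forall_isNonbacktracking hinf
  let code : ℕ → Fin 3 × ℕ := fun k => match k with
    | 0 => (0, 1)
    | 1 => (1, 1)
    | k + 2 => (2, k)
  refine hT.nonempty_iso (fun v => F (code v).1 (code v).2)
    (hF.injective hT.acyclic code ?_ ?_) ?_ ?_ ?_
  · rintro (_ | _ | k)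
    exacts [h0.1, h1.1, hnb k]
  · rintro (_ | _ | a) (_ | _ | b) h <;> simp only [code] at h ⊢ <;> omega
  · intro e e' h
    rw [Sym2.eq_iff] at h
    split_ifs at h <;> omega
  · rintro (_ | _ | k)
    · exact hF.center 0 2 ▸ (hF.arm 0).adj.symm
    · exact hF.center 1 2 ▸ (hF.arm 1).adj.symm
    · exact (hnb (k + 1)).1 k (by omega)
  · rintro (_ | _ | _ | k) w hw
    · exact ⟨0, Or.inl ⟨rfl, (hF.center 2 0).trans (h0.2 w hw).symm⟩⟩
    · exact ⟨1, Or.inl ⟨rfl, (hF.center 2 1).trans (h1.2 w hw).symm⟩⟩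
    · obtain ⟨i, rfl⟩ := hF.center_adj w (hF.center 2 0 ▸ hw)
      fin_cases i
      · exact ⟨0, Or.inr ⟨rfl, rfl⟩⟩
      · exact ⟨1, Or.inr ⟨rfl, rfl⟩⟩
      · exact ⟨2, Or.inl ⟨rfl, rfl⟩⟩
    · rcases (hF.arm 2).eq_or_eq (hnb _) hw with rfl | rfl
      · exact ⟨k + 2, Or.inr ⟨rfl, rfl⟩⟩
      · exact ⟨k + 3, Or.inl ⟨rfl, rfl⟩⟩

/-- With weights 3 at the centre and 2, 1 along each arm the local inequalities cancel, so each is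
sharp. That the arms stop after two nodes is a consequence. -/
theorem nonempty_iso_affineE6 (hT : T.IsHarmonicTree n) {F : Fin 3 → ℕ → T.V}
    (hF : T.underlying.IsStar F) (hnb : ∀ i, T.underlying.IsNonbacktracking (F i) 2) :
    Nonempty (Iso T affineE6) := by
  have hn := hT.harmonic
  have hc := hF.center
  have ec := hF.sum_first_eq hn
  have m : ∀ i, n (F i 0) + n (F i 2) ≤ 2 * n (F i 1) ∧ _ := fun i => (hnb i).add_le hn
  have l : ∀ i, n (F i 1) ≤ 2 * n (F i 2) ∧ _ := fun i => hn.one ((hnb i).1 1 (by omega)).symm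
  have m0 := m 0
  have m1 := m 1
  have m2 := m 2
  have l0 := l 0
  have l1 := l 1
  have l2 := l 2
  rw [hc 1 0] at m1
  rw [hc 2 0] at m2
  have m0' := m0.2.1 (by linarith)
  have m1' := m1.2.1 (by linarith)
  have m2' := m2.2.1 (by linarith)
  have l0' := l0.2.1 (by linarith)
  have l1' := l1.2.1 (by linarith)
  have l2' := l2.2.1 (by linarith)
  have a01 := fun i => (hnb i).1 0 (by omega)
  have a12 := fun i => (hnb i).1 1 (by omega)
  let code : Fin 7 → Fin 3 × ℕ := ![(0, 2), (0, 1), (0, 0), (1, 1), (1, 2), (2, 1), (2, 2)]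
  refine hT.nonempty_iso (fun v => F (code v).1 (code v).2)
    (hF.injective hT.acyclic code (fun v => ?_) (by decide)) (by decide) ?_ ?_
  · exact (hnb _).mono ((by decide : ∀ v, (code v).2 ≤ 2) v)
  · intro e
    fin_cases e
    exacts [(a12 0).symm, (a01 0).symm, hc 1 0 ▸ a01 1, a12 1, hc 2 0 ▸ a01 2, a12 2]
  · intro v w hw
    fin_cases v
    · exact ⟨0, Or.inl ⟨rfl, (l0' w hw).symm⟩⟩
    · rcases m0' w hw with rfl | rfl
      exacts [⟨1, Or.inl ⟨rfl, rfl⟩⟩, ⟨0, Or.inr ⟨rfl, rfl⟩⟩]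
    · obtain ⟨i, rfl⟩ := hF.center_adj w hw
      fin_cases i
      exacts [⟨1, Or.inr ⟨rfl, rfl⟩⟩, ⟨2, Or.inl ⟨rfl, rfl⟩⟩, ⟨4, Or.inl ⟨rfl, rfl⟩⟩]
    · rcases m1' w hw with rfl | rfl
      exacts [⟨2, Or.inr ⟨rfl, rfl⟩⟩, ⟨3, Or.inl ⟨rfl, rfl⟩⟩]
    · exact ⟨3, Or.inr ⟨rfl, (l1' w hw).symm⟩⟩
    · rcases m2' w hw with rfl | rfl
      exacts [⟨4, Or.inr ⟨rfl, rfl⟩⟩, ⟨5, Or.inl ⟨rfl, rfl⟩⟩]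
    · exact ⟨5, Or.inr ⟨rfl, (l2' w hw).symm⟩⟩

/-- The cancelling weights are 4 at the centre, 3, 2, 1 on the two long arms and 2 on the short one.
-/
theorem nonempty_iso_affineE7 (hT : T.IsHarmonicTree n) {F : Fin 3 → ℕ → T.V}
    (hF : T.underlying.IsStar F) (hnb1 : T.underlying.IsNonbacktracking (F 1) 3)
    (hnb2 : T.underlying.IsNonbacktracking (F 2) 3) :
    Nonempty (Iso T affineE7) := by
  have hn := hT.harmonic
  have hc := hF.center
  have ec := hF.sum_first_eq hn
  have l0 := hn.one (hF.arm 0).adj.symm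
  have p1 := (hnb1.mono (show 2 ≤ 3 by omega)).add_le hn
  have q1 := hnb1.add_le hn
  have l1 := hn.one (hnb1.1 2 (by omega)).symm
  have p2 := (hnb2.mono (show 2 ≤ 3 by omega)).add_le hn
  have q2 := hnb2.add_le hn
  have l2 := hn.one (hnb2.1 2 (by omega)).symm
  simp only [zero_add, Nat.reduceAdd] at p1 q1 l1 p2 q2 l2
  rw [hc 1 0] at p1
  rw [hc 2 0] at p2
  have l0' := l0.2.1 (by linarith)
  have p1' := p1.2.1 (by linarith)
  have q1' := q1.2.1 (by linarith)
  have l1' := l1.2.1 (by linarith)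
  have p2' := p2.2.1 (by linarith)
  have q2' := q2.2.1 (by linarith)
  have l2' := l2.2.1 (by linarith)
  let code : Fin 8 → Fin 3 × ℕ :=
    ![(1, 3), (1, 2), (1, 1), (0, 0), (2, 1), (2, 2), (2, 3), (0, 1)]
  have hnb : ∀ i : Fin 3, T.underlying.IsNonbacktracking (F i) (![1, 3, 3] i) := by
    intro i
    fin_cases i
    exacts [.one (hF.arm 0).adj, hnb1, hnb2]
  refine hT.nonempty_iso (fun v => F (code v).1 (code v).2)
    (hF.injective hT.acyclic code (fun v => ?_) (by decide)) (by decide) ?_ ?_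
  · exact (hnb _).mono ((by decide : ∀ v, (code v).2 ≤ ![1, 3, 3] (code v).1) v)
  · intro e
    fin_cases e
    exacts [(hnb1.1 2 (by omega)).symm, (hnb1.1 1 (by omega)).symm,
      hc 1 0 ▸ (hnb1.1 0 (by omega)).symm, hc 2 0 ▸ hnb2.1 0 (by omega), hnb2.1 1 (by omega),
      hnb2.1 2 (by omega), (hF.arm 0).adj]
  · intro v w hw
    fin_cases v
    · exact ⟨0, Or.inl ⟨rfl, (l1' w hw).symm⟩⟩
    · rcases q1' w hw with rfl | rfl
      exacts [⟨1, Or.inl ⟨rfl, rfl⟩⟩, ⟨0, Or.inr ⟨rfl, rfl⟩⟩]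
    · rcases p1' w hw with rfl | rfl
      exacts [⟨2, Or.inl ⟨rfl, rfl⟩⟩, ⟨1, Or.inr ⟨rfl, rfl⟩⟩]
    · obtain ⟨i, rfl⟩ := hF.center_adj w hw
      fin_cases i
      exacts [⟨6, Or.inl ⟨rfl, rfl⟩⟩, ⟨2, Or.inr ⟨rfl, rfl⟩⟩, ⟨3, Or.inl ⟨rfl, rfl⟩⟩]
    · rcases p2' w hw with rfl | rfl
      exacts [⟨3, Or.inr ⟨rfl, rfl⟩⟩, ⟨4, Or.inl ⟨rfl, rfl⟩⟩]
    · rcases q2' w hw with rfl | rfl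
      exacts [⟨4, Or.inr ⟨rfl, rfl⟩⟩, ⟨5, Or.inl ⟨rfl, rfl⟩⟩]
    · exact ⟨5, Or.inr ⟨rfl, (l2' w hw).symm⟩⟩
    · exact ⟨6, Or.inr ⟨rfl, (l0' w hw).symm⟩⟩

/-- The cancelling weights are 6 at the centre, then 3; 4, 2; and 5, 4, 3, 2, 1 along the arms. -/
theorem nonempty_iso_affineE8 (hT : T.IsHarmonicTree n) {F : Fin 3 → ℕ → T.V}
    (hF : T.underlying.IsStar F) (hnb1 : T.underlying.IsNonbacktracking (F 1) 2)
    (hnb2 : T.underlying.IsNonbacktracking (F 2) 5) :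
    Nonempty (Iso T affineE8) := by
  have hn := hT.harmonic
  have hc := hF.center
  have ec := hF.sum_first_eq hn
  have l0 := hn.one (hF.arm 0).adj.symm
  have p1 := hnb1.add_le hn
  have l1 := hn.one (hnb1.1 1 (by omega)).symm
  have p2 := (hnb2.mono (show 2 ≤ 5 by omega)).add_le hn
  have q2 := (hnb2.mono (show 3 ≤ 5 by omega)).add_le hn
  have r2 := (hnb2.mono (show 4 ≤ 5 by omega)).add_le hn
  have s2 := hnb2.add_le hn
  have l2 := hn.one (hnb2.1 4 (by omega)).symm
  simp only [zero_add, Nat.reduceAdd] at p1 l1 p2 q2 r2 s2 l2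
  rw [hc 1 0] at p1
  rw [hc 2 0] at p2
  have l0' := l0.2.1 (by linarith)
  have p1' := p1.2.1 (by linarith)
  have l1' := l1.2.1 (by linarith)
  have p2' := p2.2.1 (by linarith)
  have q2' := q2.2.1 (by linarith)
  have r2' := r2.2.1 (by linarith)
  have s2' := s2.2.1 (by linarith)
  have l2' := l2.2.1 (by linarith)
  let code : Fin 9 → Fin 3 × ℕ :=
    ![(1, 2), (1, 1), (0, 0), (2, 1), (2, 2), (2, 3), (2, 4), (2, 5), (0, 1)]
  have hnb : ∀ i : Fin 3, T.underlying.IsNonbacktracking (F i) (![1, 2, 5] i) := by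
    intro i
    fin_cases i
    exacts [.one (hF.arm 0).adj, hnb1, hnb2]
  refine hT.nonempty_iso (fun v => F (code v).1 (code v).2)
    (hF.injective hT.acyclic code (fun v => ?_) (by decide)) (by decide) ?_ ?_
  · exact (hnb _).mono ((by decide : ∀ v, (code v).2 ≤ ![1, 2, 5] (code v).1) v)
  · intro e
    fin_cases e
    exacts [(hnb1.1 1 (by omega)).symm, hc 1 0 ▸ (hnb1.1 0 (by omega)).symm,
      hc 2 0 ▸ hnb2.1 0 (by omega), hnb2.1 1 (by omega), hnb2.1 2 (by omega),
      hnb2.1 3 (by omega), hnb2.1 4 (by omega), (hF.arm 0).adj]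
  · intro v w hw
    fin_cases v
    · exact ⟨0, Or.inl ⟨rfl, (l1' w hw).symm⟩⟩
    · rcases p1' w hw with rfl | rfl
      exacts [⟨1, Or.inl ⟨rfl, rfl⟩⟩, ⟨0, Or.inr ⟨rfl, rfl⟩⟩]
    · obtain ⟨i, rfl⟩ := hF.center_adj w hw
      fin_cases i
      exacts [⟨7, Or.inl ⟨rfl, rfl⟩⟩, ⟨1, Or.inr ⟨rfl, rfl⟩⟩, ⟨2, Or.inl ⟨rfl, rfl⟩⟩]
    · rcases p2' w hw with rfl | rfl
      exacts [⟨2, Or.inr ⟨rfl, rfl⟩⟩, ⟨3, Or.inl ⟨rfl, rfl⟩⟩]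
    · rcases q2' w hw with rfl | rfl
      exacts [⟨3, Or.inr ⟨rfl, rfl⟩⟩, ⟨4, Or.inl ⟨rfl, rfl⟩⟩]
    · rcases r2' w hw with rfl | rfl
      exacts [⟨4, Or.inr ⟨rfl, rfl⟩⟩, ⟨5, Or.inl ⟨rfl, rfl⟩⟩]
    · rcases s2' w hw with rfl | rfl
      exacts [⟨5, Or.inr ⟨rfl, rfl⟩⟩, ⟨6, Or.inl ⟨rfl, rfl⟩⟩]
    · exact ⟨6, Or.inr ⟨rfl, (l2' w hw).symm⟩⟩
    · exact ⟨7, Or.inr ⟨rfl, (l0' w hw).symm⟩⟩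

/-! ### Case analysis on the branch nodes -/

theorem exists_iso_of_isStar_of_endsAt_of_endsAt (hT : T.IsHarmonicTree n) {F : Fin 3 → ℕ → T.V}
    (hF : T.underlying.IsStar F) (h0 : T.underlying.EndsAt (F 0) 0) {p : ℕ} (hp : p < 2)
    (h1 : T.underlying.EndsAt (F 1) p) : ∃ D : DiagramType, Nonempty (Iso T D.graph) := by
  obtain rfl | rfl : p = 0 ∨ p = 1 := by omega
  · exact ⟨.infD, hT.nonempty_iso_infiniteD hF h0 h1⟩
  -- Balance at the centre reads 1/2 + 2/3 + (q + 1)/(q + 2) = 2 for a finite third arm, that is q =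
  -- 4; so it cannot end earlier.
  rcases (hF.arm 2).isNonbacktracking_or_endsAt 4 with h2 | ⟨q, hq, h2⟩
  · exact ⟨.affE8, hT.nonempty_iso_affineE8 hF h1.1 h2⟩
  exfalso
  have e0 := (hF.arm 0).apply_of_endsAt hT.harmonic h0
  have e1 := (hF.arm 1).apply_of_endsAt hT.harmonic h1
  have e2 := (hF.arm 2).apply_of_endsAt hT.harmonic h2
  have e := hF.sum_first_eq hT.harmonic
  have := hT.harmonic.1 (F 0 0)
  rw [hF.center 1 0] at e1
  rw [hF.center 2 0] at e2
  push_cast at e0 e1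
  interval_cases q <;> push_cast at e2 <;> linarith

theorem exists_iso_of_isStar_of_endsAt (hT : T.IsHarmonicTree n) {F : Fin 3 → ℕ → T.V}
    (hF : T.underlying.IsStar F) (h0 : T.underlying.EndsAt (F 0) 0) :
    ∃ D : DiagramType, Nonempty (Iso T D.graph) := by
  rcases (hF.arm 1).isNonbacktracking_or_endsAt 2 with h1 | ⟨p, hp, h1⟩
  · rcases (hF.arm 2).isNonbacktracking_or_endsAt 2 with h2 | ⟨p, hp, h2⟩
    · exact ⟨.affE7, hT.nonempty_iso_affineE7 hF h1 h2⟩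
    · exact hT.exists_iso_of_isStar_of_endsAt_of_endsAt (hF.comp (Equiv.swap 1 2)) h0 hp h2
  · exact hT.exists_iso_of_isStar_of_endsAt_of_endsAt hF h0 hp h1

theorem exists_iso_of_isStar (hT : T.IsHarmonicTree n) {F : Fin 3 → ℕ → T.V}
    (hF : T.underlying.IsStar F) : ∃ D : DiagramType, Nonempty (Iso T D.graph) := by
  by_cases h : ∀ i, T.underlying.IsNonbacktracking (F i) 2
  · exact ⟨.affE6, hT.nonempty_iso_affineE6 hF h⟩
  · obtain ⟨i, hi⟩ := not_forall.1 h
    obtain ⟨p, hp, hp'⟩ := ((hF.arm i).isNonbacktracking_or_endsAt 1).resolve_left hi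
    obtain rfl : p = 0 := by omega
    exact hT.exists_iso_of_isStar_of_endsAt (hF.comp (Equiv.swap 0 i))
      (by simpa using hp')

theorem nonempty_iso_affineD (hT : T.IsHarmonicTree n) {l : ℕ} {q q' : ℕ → T.V} {a b : T.V}
    (hq : T.underlying.IsNonbacktracking q (l + 1))
    (hq' : T.underlying.IsNonbacktracking q' (l + 1)) (hqq : ∀ i ≤ l, q' i = q i)
    (hne : q (l + 1) ≠ q' (l + 1)) (ha : T.underlying.Adj (q 0) a) (hb : T.underlying.Adj (q 0) b)
    (hab : a ≠ b) (ha1 : a ≠ q 1) (hb1 : b ≠ q 1) (ha1' : a ≠ q' 1) (hb1' : b ≠ q' 1) :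
    Nonempty (Iso T (affineD (l + 4) (by omega))) := by
  have hz : T.underlying.Adj (q l) (q (l + 1)) := hq.1 l (by omega)
  have hz' : T.underlying.Adj (q l) (q' (l + 1)) := hqq l le_rfl ▸ hq'.1 l (by omega)
  obtain ⟨sa, sb, sz, sz', hmid⟩ := hT.harmonic.saturated_of_double_fork hq hq' hqq hne ha hb hab
    ha1 hb1 ha1' hb1'
  -- The single step from `q 0` to `y` is itself a non-backtracking sequence, and it leaves `q` at
  -- once.
  have hna : ∀ i ≤ l + 1, ∀ y, T.underlying.Adj (q 0) y → y ≠ q 1 → y ≠ q i := by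
    intro i hi y hy hy1 hyi
    have h1 : T.underlying.IsNonbacktracking (fun k => if k = 0 then q 0 else y) 1 :=
      .one (by simpa using hy)
    have := (h1.eq_zero_of_eq hT.acyclic (hq.mono hi) (by simp) (by simpa using hy1)
      (by simpa using hyi)).1
    omega
  have hna' : ∀ y, T.underlying.Adj (q 0) y → y ≠ q' 1 → y ≠ q' (l + 1) := by
    intro y hy hy1 hyi
    have h1 : T.underlying.IsNonbacktracking (fun k => if k = 0 then q 0 else y) 1 :=
      .one (by simpa using hy)
    have := (h1.eq_zero_of_eq hT.acyclic hq' (by simp [hqq 0]) (by simpa using hy1)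
      (by simpa using hyi)).1
    omega
  have hinj' : ∀ i ≤ l + 1, q i ≠ q' (l + 1) := by
    intro i hi h
    rcases Nat.lt_or_ge l i with hil | hil
    · obtain rfl : i = l + 1 := by omega
      exact hne h
    · rw [← hqq i hil] at h
      have := hq'.eq_of_eq hT.acyclic hi le_rfl h
      omega
  -- In the numbering of D̂_{l+4}, the prongs `a`, `b` are 0 and 1, the spine is 2, …, l + 2, and
  -- the prongs at its far end are l + 3 and l + 4.
  let f : ℕ → T.V := fun i =>
    if i = 0 then a else if i = 1 then b else if i = l + 4 then q' (l + 1) else q (i - 2)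
  have f0 : f 0 = a := rfl
  have f1 : f 1 = b := rfl
  have fl : f (l + 4) = q' (l + 1) := by simp [f]
  have fm : ∀ i ≤ l + 1, f (i + 2) = q i := fun i hi => by
    simp only [f]
    rw [if_neg (by omega), if_neg (by omega), if_neg (by omega), Nat.add_sub_cancel]
  have hcases : ∀ i < l + 5, i = 0 ∨ i = 1 ∨ i = l + 4 ∨ ∃ j ≤ l + 1, i = j + 2 := by
    intro i hi
    by_cases h : 2 ≤ i ∧ i < l + 4
    · exact Or.inr (Or.inr (Or.inr ⟨i - 2, by omega, by omega⟩))
    · omega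
  have hinj : ∀ i < l + 5, ∀ j < l + 5, f i = f j → i = j := by
    intro i hi j hj hij
    rcases hcases i hi with rfl | rfl | rfl | ⟨i, hi', rfl⟩ <;>
      rcases hcases j hj with rfl | rfl | rfl | ⟨j, hj', rfl⟩
    · rfl
    · exact absurd hij hab
    · exact absurd (hij.trans fl) (hna' a ha ha1')
    · exact absurd (hij.trans (fm j hj')) (hna j hj' a ha ha1)
    · exact absurd hij.symm hab
    · rfl
    · exact absurd (hij.trans fl) (hna' b hb hb1')
    · exact absurd (hij.trans (fm j hj')) (hna j hj' b hb hb1)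
    · exact absurd (hij.symm.trans fl) (hna' a ha ha1')
    · exact absurd (hij.symm.trans fl) (hna' b hb hb1')
    · rfl
    · exact absurd ((fm j hj').symm.trans (hij.symm.trans fl)) (hinj' j hj')
    · exact absurd (hij.symm.trans (fm i hi')) (hna i hi' a ha ha1)
    · exact absurd (hij.symm.trans (fm i hi')) (hna i hi' b hb hb1)
    · exact absurd ((fm i hi').symm.trans (hij.trans fl)) (hinj' i hi')
    · rw [fm i hi', fm j hj'] at hij
      rw [hq.eq_of_eq hT.acyclic hi' hj' hij]
  let s : Fin (l + 4) → Fin (l + 4 + 1) := fun k =>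
    if k.val = l + 4 - 1 then ⟨l + 4 - 2, by omega⟩ else ⟨k.val, by omega⟩
  let t : Fin (l + 4) → Fin (l + 4 + 1) := fun k =>
    if k.val = 0 then ⟨2, by omega⟩ else ⟨k.val + 1, by omega⟩
  have hs : ∀ k, (s k).val = if k.val = l + 3 then l + 2 else k.val := fun k => by
    simp only [s]; split_ifs <;> first | rfl | omega
  have ht : ∀ k, (t k).val = if k.val = 0 then 2 else k.val + 1 := fun k => by
    simp only [t]; split_ifs <;> rfl
  have hst : ∀ k (hk : k < l + 4) i j, (if k = l + 3 then l + 2 else k) = i →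
      (if k = 0 then 2 else k + 1) = j → (s ⟨k, hk⟩).val = i ∧ (t ⟨k, hk⟩).val = j :=
    fun k hk i j h1 h2 => ⟨(hs _).trans h1, (ht _).trans h2⟩
  refine hT.nonempty_iso (s := s) (t := t) (fun v => f v.val)
    (fun v w h => Fin.ext (hinj _ v.2 _ w.2 h)) ?_ ?_ ?_
  · intro e e' h
    rw [Sym2.eq_iff, Fin.ext_iff, Fin.ext_iff, Fin.ext_iff, Fin.ext_iff, hs, hs, ht, ht] at h
    apply Fin.ext
    split_ifs at h <;> omega
  · intro e
    simp only [hs, ht]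
    obtain ⟨e, he⟩ := e
    dsimp only
    rcases hcases e (by omega) with rfl | rfl | rfl | ⟨i, hi, rfl⟩
    · rw [if_neg (by omega), if_pos rfl, fm 0 (by omega)]
      exact ha.symm
    · rw [if_neg (by omega), if_neg (by omega), fm 0 (by omega)]
      exact hb.symm
    · omega
    · rw [if_neg (show i + 2 ≠ 0 by omega)]
      by_cases h : i = l + 1
      · subst h
        rw [if_pos rfl, fm l (by omega), fl]
        exact hz'
      · rw [if_neg (by omega), fm i hi, fm (i + 1) (by omega)]
        exact hq.1 i (by omega)
  · intro v w hw
    have hfwd : ∀ k (hk : k < l + 4) i j, (if k = l + 3 then l + 2 else k) = i →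
        (if k = 0 then 2 else k + 1) = j → i = v.val → f j = w →
        ∃ e, (s e = v ∧ f (t e) = w) ∨ (t e = v ∧ f (s e) = w) := by
      intro k hk i j h1 h2 h3 h4
      obtain ⟨h5, h6⟩ := hst k hk i j h1 h2
      exact ⟨⟨k, hk⟩, Or.inl ⟨Fin.ext (h5.trans h3), by rw [h6, h4]⟩⟩
    have hbwd : ∀ k (hk : k < l + 4) i j, (if k = l + 3 then l + 2 else k) = i →
        (if k = 0 then 2 else k + 1) = j → j = v.val → f i = w →
        ∃ e, (s e = v ∧ f (t e) = w) ∨ (t e = v ∧ f (s e) = w) := by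
      intro k hk i j h1 h2 h3 h4
      obtain ⟨h5, h6⟩ := hst k hk i j h1 h2
      exact ⟨⟨k, hk⟩, Or.inr ⟨Fin.ext (h6.trans h3), by rw [h5, h4]⟩⟩
    obtain ⟨v, hv⟩ := v
    rcases hcases v hv with rfl | rfl | rfl | ⟨i, hi, rfl⟩
    · refine hfwd 0 (by omega) 0 2 (if_neg (by omega)) rfl rfl ?_
      rw [sa w hw, fm 0 (by omega)]
    · refine hfwd 1 (by omega) 1 2 (if_neg (by omega)) rfl rfl ?_
      rw [sb w hw, fm 0 (by omega)]
    · rw [fl] at hw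
      refine hbwd (l + 3) (by omega) (l + 2) (l + 4) (if_pos rfl) (if_neg (by omega)) rfl ?_
      rw [sz' w hw, fm l (by omega)]
    · rw [fm i hi] at hw
      rcases Nat.lt_or_ge l i with hil | hil
      · obtain rfl : i = l + 1 := by omega
        refine hbwd (l + 2) (by omega) (l + 2) (l + 3) (if_neg (by omega)) (if_neg (by omega))
          rfl ?_
        rw [sz w hw, fm l (by omega)]
      rcases hmid i hil w hw with ⟨rfl, rfl | rfl⟩ | ⟨hipos, rfl⟩ | rfl | ⟨rfl, rfl⟩
      · exact hbwd 0 (by omega) 0 2 (if_neg (by omega)) rfl rfl f0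
      · exact hbwd 1 (by omega) 1 2 (if_neg (by omega)) rfl rfl f1
      · refine hbwd (i + 1) (by omega) (i + 1) (i + 2) (if_neg (by omega)) (if_neg (by omega))
          rfl ?_
        have := fm (i - 1) (by omega)
        rwa [show i - 1 + 2 = i + 1 by omega] at this
      · exact hfwd (i + 2) (by omega) (i + 2) (i + 3) (if_neg (by omega)) (if_neg (by omega)) rfl
          (fm (i + 1) (by omega))
      · exact hfwd (i + 3) (by omega) (i + 2) (i + 4) (if_pos rfl) (if_neg (by omega)) rfl fl

theorem exists_iso_of_four_neighbors (hT : T.IsHarmonicTree n) {c a b d e : T.V}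
    (ha : T.underlying.Adj c a) (hb : T.underlying.Adj c b) (hd : T.underlying.Adj c d)
    (he : T.underlying.Adj c e) (hab : a ≠ b) (had : a ≠ d) (hae : a ≠ e) (hbd : b ≠ d)
    (hbe : b ≠ e) (hde : d ≠ e) : ∃ D : DiagramType, Nonempty (Iso T D.graph) :=
  ⟨.affD 4 le_rfl, hT.nonempty_iso_affineD (l := 0) (q := fun i => if i = 0 then c else d)
    (q' := fun i => if i = 0 then c else e) (a := a) (b := b) (.one hd) (.one he)
    (fun i hi => by simp [show i = 0 by omega]) hde ha hb hab had hbd hae hbe⟩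

/-- The path from `c` to `d` is the spine of a double fork: each end has two neighbours besides its
neighbour on the path. -/
theorem exists_iso_of_isBranch_of_isBranch (hT : T.IsHarmonicTree n) {c d : T.V} (hcd : c ≠ d)
    (hc : T.underlying.IsBranch c) (hd : T.underlying.IsBranch d) :
    ∃ D : DiagramType, Nonempty (Iso T D.graph) := by
  obtain ⟨p, hp⟩ := (hT.connected.preconnected c d).exists_isPath
  obtain ⟨l, hl⟩ : ∃ l, p.length = l + 1 := by
    refine ⟨p.length - 1, ?_⟩
    have : p.length ≠ 0 := fun h => hcd (Walk.eq_of_length_eq_zero h)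
    omega
  have hpl : p.getVert (l + 1) = d := hl ▸ p.getVert_length
  obtain ⟨a, b, ha, hb, hab, ha1, hb1⟩ := hc.exists_avoiding (p.getVert 1)
  obtain ⟨y, z, hy, hz, hyz, hy1, hz1⟩ := hd.exists_avoiding (p.getVert l)
  let ext : T.V → ℕ → T.V := fun y i => if i ≤ l + 1 then p.getVert i else y
  have e1 : ∀ y, ∀ i ≤ l + 1, ext y i = p.getVert i := fun y i hi => if_pos hi
  have e2 : ∀ y, ext y (l + 2) = y := fun y => if_neg (by omega)
  have hnb : ∀ y, T.underlying.Adj d y → y ≠ p.getVert l →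
      T.underlying.IsNonbacktracking (ext y) (l + 2) := by
    intro y hy hyl
    refine IsNonbacktracking.succ ⟨fun i hi => ?_, fun i hi => ?_⟩ ?_ ?_
    · rw [e1 y i (by omega), e1 y (i + 1) (by omega)]
      exact p.adj_getVert_succ (by omega)
    · rw [e1 y i (by omega), e1 y (i + 2) (by omega)]
      intro h
      have := hp.getVert_injOn (by rw [Set.mem_ofPred_eq]; omega)
        (by rw [Set.mem_ofPred_eq]; omega) h
      omega
    · rw [e1 y (l + 1) le_rfl, e2, hpl]
      exact hy
    · rw [e1 y l (by omega), e2]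
      exact hyl.symm
  have e0 : ∀ y, ext y 0 = c := fun y => (e1 y 0 (by omega)).trans p.getVert_zero
  refine ⟨.affD (l + 1 + 4) (by omega), hT.nonempty_iso_affineD (hnb y hy hy1) (hnb z hz hz1)
    (fun i hi => (e1 z i hi).trans (e1 y i hi).symm) ?_ (a := a) (b := b) ?_ ?_ hab ?_ ?_ ?_ ?_⟩
  · rw [e2, e2]
    exact hyz
  · rwa [e0]
  · rwa [e0]
  all_goals rwa [e1 _ 1 (by omega)]

theorem exists_iso_of_isBranch (hT : T.IsHarmonicTree n) {c : T.V}
    (hc : T.underlying.IsBranch c) (hbr : ∀ v, v ≠ c → ¬ T.underlying.IsBranch v) :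
    ∃ D : DiagramType, Nonempty (Iso T D.graph) := by
  obtain ⟨a, b, d, ha, hb, hd, hab, had, hbd⟩ := hc
  by_cases h4 : ∃ e, T.underlying.Adj c e ∧ a ≠ e ∧ b ≠ e ∧ d ≠ e
  · obtain ⟨e, he, hae, hbe, hde⟩ := h4
    exact hT.exists_iso_of_four_neighbors ha hb hd he hab had hae hbd hbe hde
  obtain ⟨α, α0, α1, hα⟩ := exists_isArm hT.acyclic ha hbr
  obtain ⟨β, β0, β1, hβ⟩ := exists_isArm hT.acyclic hb hbr
  obtain ⟨γ, γ0, γ1, hγ⟩ := exists_isArm hT.acyclic hd hbr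
  have h0 : ∀ i, (![α, β, γ] : Fin 3 → ℕ → T.V) i 0 = c := by
    intro i
    fin_cases i
    exacts [α0, β0, γ0]
  have h1 : ∀ i, (![α, β, γ] : Fin 3 → ℕ → T.V) i 1 = (![a, b, d] : Fin 3 → T.V) i := by
    intro i
    fin_cases i
    exacts [α1, β1, γ1]
  refine hT.exists_iso_of_isStar (F := ![α, β, γ])
    ⟨⟨fun i j => (h0 i).trans (h0 j).symm, fun i j h => ?_⟩, fun i => ?_, fun x hx => ?_⟩
  · rw [h1, h1] at h
    fin_cases i <;> fin_cases j <;> first | rfl | skip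
    exacts [absurd h hab, absurd h had, absurd h.symm hab, absurd h hbd, absurd h.symm had,
      absurd h.symm hbd]
  · fin_cases i
    exacts [hα, hβ, hγ]
  · rw [h0] at hx
    by_contra! hne
    exact h4 ⟨x, hx, fun h => hne 0 ((h1 0).trans h).symm, fun h => hne 1 ((h1 1).trans h).symm,
      fun h => hne 2 ((h1 2).trans h).symm⟩

/-- A leaf makes n double in the first step away from it, whereas a chain that ends again would need
n to decrease there. So a chain with a leaf is A_∞, and otherwise it extends both ways for ever. -/
theorem exists_iso_of_forall_not_isBranch (hT : T.IsHarmonicTree n)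
    (hbr : ∀ v, ¬ T.underlying.IsBranch v) : ∃ D : DiagramType, Nonempty (Iso T D.graph) := by
  have hn := hT.harmonic
  by_cases hleaf : ∃ c x, T.underlying.Adj c x ∧ ∀ y, T.underlying.Adj c y → y = x
  · obtain ⟨c, x, hcx, hc⟩ := hleaf
    obtain ⟨h, rfl, rfl, harm⟩ := exists_isArm hT.acyclic hcx fun v _ => hbr v
    refine ⟨.infA, hT.nonempty_iso_infiniteA (harm.forall_isNonbacktracking fun p hp => ?_) hc harm⟩
    have h1 := harm.apply_of_endsAt hn hp
    have h2 := (hn.one hcx).2.2 hc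
    have h3 : (0 : ℚ) ≤ p := p.cast_nonneg
    have h4 := hn.1 (h 0)
    nlinarith [mul_le_mul_of_nonneg_left h2 (show (0 : ℚ) ≤ p + 2 by linarith),
      mul_nonneg h3 h4.le]
  · have hend : ∀ h p, ¬ T.underlying.EndsAt h p := fun h p hp =>
      hleaf ⟨_, _, (hp.1.1 p (by omega)).symm, hp.2⟩
    obtain ⟨c⟩ := hT.connected.nonempty
    obtain ⟨x, hx⟩ := hn.exists_adj c
    obtain ⟨y, hy, hyx⟩ : ∃ y, T.underlying.Adj c y ∧ y ≠ x := by
      by_contra! h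
      exact hleaf ⟨c, x, hx, h⟩
    obtain ⟨h, h0, rfl, harm⟩ := exists_isArm hT.acyclic hx fun v _ => hbr v
    obtain ⟨h', h0', rfl, harm'⟩ := exists_isArm hT.acyclic hy fun v _ => hbr v
    refine ⟨.biinfA, hT.nonempty_iso_biinfiniteA (harm.forall_isNonbacktracking (hend h))
      (harm'.forall_isNonbacktracking (hend h')) harm harm' (h0.trans h0'.symm) hyx.symm
      fun z hz => ?_⟩
    rw [h0] at hz
    exact eq_or_eq_of_not_isBranch (hbr c) hx hy hyx.symm hz

theorem exists_iso (hT : T.IsHarmonicTree n) : ∃ D : DiagramType, Nonempty (Iso T D.graph) := by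
  by_cases h1 : ∃ c, T.underlying.IsBranch c
  · obtain ⟨c, hc⟩ := h1
    by_cases h2 : ∃ d, d ≠ c ∧ T.underlying.IsBranch d
    · obtain ⟨d, hdc, hd⟩ := h2
      exact hT.exists_iso_of_isBranch_of_isBranch hdc hd hc
    · exact hT.exists_iso_of_isBranch hc fun v hv hb => h2 ⟨v, hv, hb⟩
  · exact hT.exists_iso_of_forall_not_isBranch fun v hv => h1 ⟨v, hv⟩

end IsHarmonicTree

theorem IsBalanced.exists_iso {T : LabelledGraph.{u, v}} (hloop : T.Loopless)
    (hlaced : T.IsSimplyLaced) {n : T.V → ℚ} (hn : T.IsBalanced n)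
    (hconn : T.underlying.Connected) : ∃ D : DiagramType, Nonempty (Iso T D.graph) := by
  by_cases hT : T.NoMultipleEdges
  · by_cases hG : T.underlying.IsAcyclic
    · exact IsHarmonicTree.exists_iso (n := n)
        ⟨hloop, hlaced, hconn, hT, hG, hn.1, hn.exists_neighbors hloop hT⟩
    · obtain ⟨m, hm, h⟩ := nonempty_iso_of_not_isAcyclic hloop hlaced hconn hn hG
      exact ⟨.affA m hm, h⟩
  · exact ⟨.affA 1 le_rfl, nonempty_iso_of_not_noMultipleEdges hloop hlaced hconn hn hT⟩

/-! ### Connected components and disjoint unions -/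

/-- The connected component `c` of a labelled graph. -/
def component (T : LabelledGraph.{u, v}) (c : T.underlying.ConnectedComponent) :
    LabelledGraph.{u, v} where
  V := {i // T.underlying.connectedComponentMk i = c}
  E := {γ // T.underlying.connectedComponentMk (T.src γ) = c ∧
    T.underlying.connectedComponentMk (T.tgt γ) = c}
  src γ := ⟨T.src γ.1, γ.2.1⟩
  tgt γ := ⟨T.tgt γ.1, γ.2.2⟩
  label γ := T.label γ.1
  label_fst_pos γ := T.label_fst_pos γ.1
  label_snd_pos γ := T.label_snd_pos γ.1

theorem connectedComponentMk_src_eq_tgt {T : LabelledGraph.{u, v}} (hloop : T.Loopless) (γ : T.E) :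
    T.underlying.connectedComponentMk (T.src γ) = T.underlying.connectedComponentMk (T.tgt γ) :=
  ConnectedComponent.sound
    ((underlying_adj hloop).2 ⟨γ, Or.inl ⟨rfl, rfl⟩⟩ : T.underlying.Adj _ _).reachable

theorem component_connected {T : LabelledGraph.{u, v}} (hloop : T.Loopless)
    (c : T.underlying.ConnectedComponent) : (T.component c).underlying.Connected := by
  have hloop' : (T.component c).Loopless := fun γ h => hloop γ.1 (congrArg Subtype.val h)
  have hadj : ∀ i j : (T.component c).V, T.underlying.Adj i.1 j.1 →
      (T.component c).underlying.Adj i j := by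
    rintro ⟨i, hi⟩ ⟨j, hj⟩ h
    obtain ⟨γ, hγ⟩ := (underlying_adj hloop).1 h
    refine (underlying_adj hloop').2 ?_
    rcases hγ with ⟨rfl, rfl⟩ | ⟨rfl, rfl⟩
    · exact ⟨⟨γ, hi, hj⟩, Or.inl ⟨rfl, rfl⟩⟩
    · exact ⟨⟨γ, hj, hi⟩, Or.inr ⟨rfl, rfl⟩⟩
  have hwalk : ∀ {i j : T.V} (p : T.underlying.Walk i j)
      (hi : T.underlying.connectedComponentMk i = c) (hj : T.underlying.connectedComponentMk j = c),
      (T.component c).underlying.Reachable ⟨i, hi⟩ ⟨j, hj⟩ := by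
    intro i j p
    induction p with
    | nil => exact fun _ _ => Reachable.refl _
    | @cons i k j h p ih =>
      intro hi hj
      have hk : T.underlying.connectedComponentMk k = c :=
        (ConnectedComponent.sound h.symm.reachable).trans hi
      exact (hadj ⟨i, hi⟩ ⟨k, hk⟩ h).reachable.trans (ih hk hj)
  have : Nonempty (T.component c).V := by
    obtain ⟨i, hi⟩ := c.exists_rep
    exact ⟨⟨i, hi⟩⟩
  refine ⟨fun i j => ?_⟩
  obtain ⟨p⟩ := ConnectedComponent.exact (i.2.trans j.2.symm)
  exact hwalk p i.2 j.2

theorem IsBalanced.component {T : LabelledGraph.{u, v}} (hloop : T.Loopless) {n : T.V → ℚ}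
    (hn : T.IsBalanced n) (c : T.underlying.ConnectedComponent) :
    (T.component c).IsBalanced fun i => n i.1 := by
  classical
  refine ⟨fun i => hn.1 _, fun j => ?_⟩
  obtain ⟨S, hS, hsum⟩ := hn.2 j.1
  have hmem : ∀ γ ∈ S, T.underlying.connectedComponentMk (T.src γ) = c ∧
      T.underlying.connectedComponentMk (T.tgt γ) = c := by
    intro γ hγ
    have h := connectedComponentMk_src_eq_tgt hloop γ
    rcases (hS γ).1 hγ with h' | h'
    · exact ⟨h' ▸ j.2, h ▸ h' ▸ j.2⟩
    · exact ⟨h ▸ h' ▸ j.2, h' ▸ j.2⟩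
  let S' : Finset (T.component c).E := S.subtype _
  refine ⟨S', fun γ => ?_, ?_⟩
  · rw [show γ ∈ S' ↔ γ.1 ∈ S from Finset.mem_subtype, hS]
    exact or_congr (Subtype.ext_iff (a1 := (T.component c).src γ) (a2 := j)).symm
      (Subtype.ext_iff (a1 := (T.component c).tgt γ) (a2 := j)).symm
  · have hother : ∀ γ : (T.component c).E, ((T.component c).other γ j).1 = T.other γ.1 j.1 := by
      intro γ
      have : (T.component c).src γ = j ↔ T.src γ.1 = j.1 := Subtype.ext_iff
      simp only [other, this]
      split_ifs <;> rfl
    exact ((Finset.sum_congr rfl fun γ _ => congrArg n (hother γ)).trans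
      (Finset.sum_subtype_of_mem (fun γ => n (T.other γ j.1)) hmem)).trans hsum

theorem nonempty_iso_disjointUnion {T : LabelledGraph.{u, v}} (hloop : T.Loopless) {ι : Type w}
    (e : ι ≃ T.underlying.ConnectedComponent) (G : ι → LabelledGraph.{0, 0})
    (hG : ∀ i, Nonempty (Iso (T.component (e i)) (G i))) :
    Nonempty (Iso T (disjointUnion G)) := by
  let I := fun i => (hG i).some
  let κ : T.V → ι := fun v => e.symm (T.underlying.connectedComponentMk v)
  have hκ : ∀ v, T.underlying.connectedComponentMk v = e (κ v) := fun v =>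
    (e.apply_symm_apply _).symm
  have hst : ∀ γ, T.underlying.connectedComponentMk (T.tgt γ) = e (κ (T.src γ)) := fun γ =>
    (connectedComponentMk_src_eq_tgt hloop γ).symm.trans (hκ _)
  have huniq : ∀ v i, T.underlying.connectedComponentMk v = e i → κ v = i := fun v i h =>
    (congrArg e.symm h).trans (e.symm_apply_apply i)
  let N : T.V → (disjointUnion G).V := fun v => ⟨κ v, (I (κ v)).nodes ⟨v, hκ v⟩⟩
  let M : T.E → (disjointUnion G).E := fun γ =>
    ⟨κ (T.src γ), (I (κ (T.src γ))).edges ⟨γ, hκ _, hst γ⟩⟩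
  -- With the index `i` free, the images of two nodes of one component can be compared in the same
  -- summand, without transport along equalities of indices.
  have hN : ∀ v i (h : T.underlying.connectedComponentMk v = e i),
      N v = ⟨i, (I i).nodes ⟨v, h⟩⟩ := by
    intro v i h
    obtain rfl := huniq v i h
    rfl
  have hM : ∀ γ i (h : _ ∧ _), M γ = ⟨i, (I i).edges ⟨γ, h⟩⟩ := by
    intro γ i h
    obtain rfl := huniq _ i h.1
    rfl
  have hNb : Function.Bijective N := by
    refine ⟨fun v w h => ?_, ?_⟩
    · have h1 : κ v = κ w := congrArg Sigma.fst h
      rw [hN v (κ v) (hκ v), hN w (κ v) (h1 ▸ hκ w)] at h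
      have := (I (κ v)).nodes.injective (eq_of_heq (Sigma.mk.inj h).2)
      exact congrArg Subtype.val this
    · rintro ⟨i, y⟩
      refine ⟨((I i).nodes.symm y).1, ?_⟩
      rw [hN _ i ((I i).nodes.symm y).2]
      exact congrArg (Sigma.mk i) ((I i).nodes.apply_symm_apply y)
  have hMb : Function.Bijective M := by
    refine ⟨fun γ δ h => ?_, ?_⟩
    · have h1 : κ (T.src γ) = κ (T.src δ) := congrArg Sigma.fst h
      rw [hM γ (κ (T.src γ)) ⟨hκ _, hst γ⟩,
        hM δ (κ (T.src γ)) ⟨h1 ▸ hκ _, h1 ▸ hst δ⟩] at h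
      have := (I (κ (T.src γ))).edges.injective (eq_of_heq (Sigma.mk.inj h).2)
      exact congrArg Subtype.val this
    · rintro ⟨i, y⟩
      refine ⟨((I i).edges.symm y).1, ?_⟩
      rw [hM _ i ((I i).edges.symm y).2]
      exact congrArg (Sigma.mk i) ((I i).edges.apply_symm_apply y)
  refine ⟨⟨Equiv.ofBijective N hNb, Equiv.ofBijective M hMb, fun γ => ?_⟩⟩
  simp only [Equiv.ofBijective_apply]
  rw [hN (T.src γ) (κ (T.src γ)) (hκ _), hN (T.tgt γ) (κ (T.src γ)) (hst γ)]
  have hl : ∀ (i : ι) (y : (G i).E),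
    (disjointUnion G).src ⟨i, y⟩ = ⟨i, (G i).src y⟩ ∧
    (disjointUnion G).tgt ⟨i, y⟩ = ⟨i, (G i).tgt y⟩ ∧
    (disjointUnion G).label ⟨i, y⟩ = (G i).label y := fun i y => ⟨rfl, rfl, rfl⟩
  obtain ⟨h1, h2, h3⟩ := hl (κ (T.src γ)) ((I (κ (T.src γ))).edges ⟨γ, hκ _, hst γ⟩)
  rcases (I (κ (T.src γ))).compat ⟨γ, hκ _, hst γ⟩ with ⟨k1, k2, k3⟩ | ⟨k1, k2, k3⟩
  · exact Or.inl ⟨h1.trans (congrArg _ k1), h2.trans (congrArg _ k2), h3.trans k3⟩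
  · exact Or.inr ⟨h1.trans (congrArg _ k1), h2.trans (congrArg _ k2), h3.trans k3⟩

theorem IsBalanced.exists_iso_component {T : LabelledGraph.{u, v}} (hloop : T.Loopless)
    (hlaced : T.IsSimplyLaced) {n : T.V → ℚ} (hn : T.IsBalanced n)
    (c : T.underlying.ConnectedComponent) :
    ∃ D : DiagramType, Nonempty (Iso (T.component c) D.graph) :=
  (hn.component hloop c).exists_iso (fun γ h => hloop γ.1 (congrArg Subtype.val h))
    (fun γ => hlaced γ.1) (component_connected hloop c)

end LabelledGraph

theorem mainTheorem1 (T : LabelledGraph.{u, v}) (hloop : T.Loopless)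
    (hfin : T.FiniteMultiplicity) (hlaced : T.IsSimplyLaced)
    (n : T.V → ℚ) (hn : T.IsAdditive n) :
    (T.underlying.Connected →
      ∃ D : LabelledGraph.DiagramType, Nonempty (LabelledGraph.Iso T D.graph)) ∧
    (Finite T.underlying.ConnectedComponent →
      ∃ (k : ℕ) (D : Fin k → LabelledGraph.DiagramType),
        Nonempty (LabelledGraph.Iso T (LabelledGraph.disjointUnion fun i => (D i).graph))) ∧
    (∃ D : T.underlying.ConnectedComponent → LabelledGraph.DiagramType,
      Nonempty (LabelledGraph.Iso T (LabelledGraph.disjointUnion fun c => (D c).graph))) := by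
  have hb := hn.isBalanced hloop hfin hlaced
  choose D hD using hb.exists_iso_component hloop hlaced
  refine ⟨hb.exists_iso hloop hlaced, fun hfinite => ?_,
    D, LabelledGraph.nonempty_iso_disjointUnion hloop (Equiv.refl _) _ hD⟩
  obtain ⟨k, ⟨e⟩⟩ := Finite.exists_equiv_fin T.underlying.ConnectedComponent
  exact ⟨k, D ∘ e.symm,
    LabelledGraph.nonempty_iso_disjointUnion hloop e.symm _ fun i => hD (e.symm i)⟩
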